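/- Let $\mathcal A$ be a finite nonempty set of $N$ agents and $\mathcal K$ a finite set of global constraints. For each $i\in\mathcal A$ let $\mathcal G_i\subset\mathbb R^{n_i}$ be nonempty, compact and convex, and let $\phi_i$ and $g_{i,k}$ ($k\in\mathcal K$) be real functions that are convex, Lipschitz continuous and differentiable on $\mathcal G_i$, with gradients $\nabla\phi_i$, $\nabla g_{i,k}$ there (differentiability is meant relative to $\mathcal G_i$; where $\mathcal G_i$ does not determine the gradient uniquely, any choice is allowed). Put $\mathcal G=\prod_i\mathcal G_i$, $[x]_+=\max(0,x)$, $g_k(\mathbf y)=\sum_i g_{i,k}(\mathbf y_i)$, let $\mu>0$ and $$\Phi(\mathbf y)=\sum_{i\in\mathcal A}\phi_i(\mathbf y_i)+\frac{\mu}{2N}\sum_{k\in\mathcal K}\big([g_k(\mathbf y)]_+\big)^2,\qquad \mathcal Y^*=\operatorname*{arg\,min}_{\mathbf y\in\mathcal G}\Phi(\mathbf y).$$ Let $W=[w_{ij}]_{i,j\in\mathcal A}$ be a doubly stochastic matrix whose associated directed graph (with an edge $i\to j$ iff $w_{ij}>0$) is strongly connected and aperiodic, i.e. some power $W^m$, $m\ge1$,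 has only positive entries. Let $\gamma_t\ge0$, $t=0,1,2,\dots$, be step sizes with $\sum_t\gamma_t=\infty$ and $\sum_t\gamma_t^2<\infty$. On a probability space, let $\mathbf y(t)$ and $\mathbf V(t)$ be random vectors in $\prod_i\mathbb R^{n_i}$ and $\mathbf e_i(t)\in\mathbb R^{\mathcal K}$ be such that $\mathbf y(0)\in\mathcal G$, $e_{i,k}(0)=g_{i,k}(\mathbf y_i(0))$ and, for all $t$, $i$, $k$, $$\mathbf y_i(t+1)=P_{\mathcal G_i}\big(\mathbf y_i(t)+\gamma_t\mathbf U_i(t)\big),\qquad \mathbf U_i(t)=-\nabla\phi_i(\mathbf y_i(t))-\mu\sum_{k\in\mathcal K}\nabla g_{i,k}(\mathbf y_i(t))\,[e_{i,k}(t)]_+ +\mathbf V_i(t),$$ $$e_{i,k}(t+1)=\sum_{j\in\mathcal A}w_{ij}e_{j,k}(t)+g_{i,k}(\mathbf y_i(t+1))-g_{i,k}(\mathbf y_i(t)),$$ where $P_{\mathcal G_i}$ is the Euclidean projection onto $\mathcal G_i$. Assume that there is a Markov kernel $\mathbf y\mapsto\nu_{\mathbf y}$ such that for every $t$ the conditional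 distribution of $\mathbf V(t)$ given $\mathbf y(t)=\mathbf y$ is $\nu_{\mathbf y}$, and that $\int\mathbf v\,\nu_{\mathbf y}(d\mathbf v)=\mathbf 0$ for every $\mathbf y\in\mathcal G$ and $\sup_{\mathbf y\in\mathcal G}\int\|\mathbf v\|_2^2\,\nu_{\mathbf y}(d\mathbf v)<\infty$. Then $\mathcal Y^*\neq\emptyset$ and, with $d_{\mathcal Y^*}(\mathbf y)=\inf\{\|\mathbf y-\mathbf y^*\|_2:\mathbf y^*\in\mathcal Y^*\}$, $$\mathbb P\Big(\lim_{t\to\infty}d_{\mathcal Y^*}(\mathbf y(t))=0\Big)=1.$$ -/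

import Mathlib

namespace PenaltyConsensus

/-- The space of joint decision vectors `y = (y_i)`, where agent `i` has `n i` real decision
variables, with the `ℓ²` norm of the concatenated vector. -/
abbrev Decision {ι : Type*} (n : ι → ℕ) : Type _ :=
  PiLp 2 fun i => EuclideanSpace ℝ (Fin (n i))

/-- The product `𝒢 = ∏ 𝒢_i` of the local constraint sets. -/
def feasibleSet {ι : Type*} {n : ι → ℕ} (G : ∀ i, Set (EuclideanSpace ℝ (Fin (n i)))) :
    Set (Decision n) :=
  {y | ∀ i, y i ∈ G i}

/-- The global constraint function `g_k(y) = ∑ i, g_{i,k}(y_i)`. -/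
def globalConstraint {ι κ : Type*} [Fintype ι] {n : ι → ℕ}
    (g : ∀ i, κ → EuclideanSpace ℝ (Fin (n i)) → ℝ) (k : κ) (y : Decision n) : ℝ :=
  ∑ i, g i k (y i)

/-- The penalized objective
`Φ(y) = ∑ i, φ_i(y_i) + μ / (2 N) * ∑ k, ([g_k(y)]_+)²`, with `N` the number of agents. -/
noncomputable def penalizedObjective {ι κ : Type*} [Fintype ι] [Fintype κ] {n : ι → ℕ}
    (φ : ∀ i, EuclideanSpace ℝ (Fin (n i)) → ℝ)
    (g : ∀ i, κ → EuclideanSpace ℝ (Fin (n i)) → ℝ) (μ : ℝ) (y : Decision n) : ℝ :=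
  ∑ i, φ i (y i) +
    μ / (2 * (Fintype.card ι : ℝ)) * ∑ k, (max 0 (globalConstraint g k y)) ^ 2

/-- The set of minimizers of the penalized objective over `𝒢`. -/
def optimalSet {ι κ : Type*} [Fintype ι] [Fintype κ] {n : ι → ℕ}
    (G : ∀ i, Set (EuclideanSpace ℝ (Fin (n i))))
    (φ : ∀ i, EuclideanSpace ℝ (Fin (n i)) → ℝ)
    (g : ∀ i, κ → EuclideanSpace ℝ (Fin (n i)) → ℝ) (μ : ℝ) : Set (Decision n) :=
  {y | y ∈ feasibleSet G ∧
    ∀ z ∈ feasibleSet G, penalizedObjective φ g μ y ≤ penalizedObjective φ g μ z}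

/-- `p` is the Euclidean projection of `x` onto `S` (unique if `S` is convex). -/
def IsEuclideanProj {E : Type*} [NormedAddCommGroup E] (S : Set E) (x p : E) : Prop :=
  p ∈ S ∧ ∀ q ∈ S, ‖x - p‖ ≤ ‖x - q‖

/-- The update direction of agent `i`,
`U_i = -∇φ_i(y_i) - μ ∑ k, [e_{i,k}]_+ ∇g_{i,k}(y_i) + V_i`. -/
noncomputable def updateDirection {ι κ : Type*} [Fintype κ] {n : ι → ℕ}
    (gradφ : ∀ i, EuclideanSpace ℝ (Fin (n i)) → EuclideanSpace ℝ (Fin (n i)))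
    (gradg : ∀ i, κ → EuclideanSpace ℝ (Fin (n i)) → EuclideanSpace ℝ (Fin (n i)))
    (μ : ℝ) (y : Decision n) (e : ι → κ → ℝ) (V : Decision n) (i : ι) :
    EuclideanSpace ℝ (Fin (n i)) :=
  -gradφ i (y i) - μ • ∑ k, max 0 (e i k) • gradg i k (y i) + V i

/-- The sequences `y(t)` (decisions) and `e(t)` (estimates of the constraint functions) are
generated by the algorithm from the perturbations `V(t)` with step sizes `γ_t`. -/
structure IsTrajectory {ι κ : Type*} [Fintype ι] [Fintype κ] {n : ι → ℕ}
    (G : ∀ i, Set (EuclideanSpace ℝ (Fin (n i))))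
    (gradφ : ∀ i, EuclideanSpace ℝ (Fin (n i)) → EuclideanSpace ℝ (Fin (n i)))
    (g : ∀ i, κ → EuclideanSpace ℝ (Fin (n i)) → ℝ)
    (gradg : ∀ i, κ → EuclideanSpace ℝ (Fin (n i)) → EuclideanSpace ℝ (Fin (n i)))
    (μ : ℝ) (W : Matrix ι ι ℝ) (γ : ℕ → ℝ)
    (V : ℕ → Decision n) (y : ℕ → Decision n) (e : ℕ → ι → κ → ℝ) : Prop where
  y_zero : y 0 ∈ feasibleSet G
  e_zero : ∀ i k, e 0 i k = g i k (y 0 i)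
  y_succ : ∀ t i, IsEuclideanProj (G i)
    (y t i + γ t • updateDirection gradφ gradg μ (y t) (e t) (V t) i) (y (t + 1) i)
  e_succ : ∀ t i k, e (t + 1) i k =
    ∑ j, W i j * e t j k + g i k (y (t + 1) i) - g i k (y t i)

end PenaltyConsensus

/-!
The consensus matrix contracts disagreement, so up to a geometrically contracting error the
estimates `e_i` follow the average of the constraint values, whose positive part enters `∇Φ`. As the
constraint values move no faster than `y`, the trajectory is a projected subgradient run for `Φ`
with a bias that contracts up to the length of the last step, and such a bias is summable against
the step sizes. Summing the recursion for `‖y(t) - y*‖²` and taking expectations, where the centred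
noise drops out, gives `∑ γ_t 𝔼[Φ(y(t)) - Φ*] < ∞`. Almost surely one step then moves `y` by at most
a constant times `s_t = γ_t (1 + ‖V(t)‖)`, with `∑ s_t = ∞`, `∑ s_t² < ∞` and
`∑ s_t (Φ(y(t)) - Φ*) < ∞`. This forces `Φ(y(t)) → Φ*`, and compactness of `𝒢` turns convergence of
the values into convergence of the distances.
-/

namespace PenaltyConsensus

open Filter Topology Finset MeasureTheory ProbabilityTheory
open scoped RealInnerProductSpace Matrix.Module

/-! ### Real sequences -/

lemma exists_tendsto_of_le_add_summable {u a : ℕ → ℝ} (hu : ∀ t, 0 ≤ u t)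
    (hstep : ∀ t, u (t + 1) ≤ u t + a t) (ha : Summable a) : ∃ l, Tendsto u atTop (𝓝 l) := by
  have hanti : Antitone fun t => u t - ∑ s ∈ range t, a s := by
    refine antitone_nat_of_succ_le fun t => ?_
    rw [sum_range_succ]
    linarith [hstep t]
  have hsum := ha.hasSum.tendsto_sum_nat
  obtain ⟨B, hB⟩ := hsum.bddAbove_range
  have hbdd : BddBelow (Set.range fun t => u t - ∑ s ∈ range t, a s) := by
    refine ⟨-B, Set.forall_mem_range.2 fun t => ?_⟩
    linarith [hu t, Set.forall_mem_range.1 hB t]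
  exact ⟨_, ((tendsto_atTop_ciInf hanti hbdd).add hsum).congr fun t => sub_add_cancel _ _⟩

lemma tendsto_zero_of_summable_mul {f s : ℕ → ℝ} {L : ℝ} (hf : ∀ t, 0 ≤ f t)
    (hs : ∀ t, 0 ≤ s t) (hstep : ∀ t, f (t + 1) ≤ f t + L * s t)
    (hsf : Summable fun t => s t * f t) (hs2 : Summable fun t => s t ^ 2)
    (hsum : ¬ Summable s) : Tendsto f atTop (𝓝 0) := by
  obtain ⟨l, hl⟩ : ∃ l, Tendsto (fun t => f t ^ 2) atTop (𝓝 l) := by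
    refine exists_tendsto_of_le_add_summable (a := fun t => 2 * L * (s t * f t) + L ^ 2 * s t ^ 2)
      (fun t => sq_nonneg _) (fun t => ?_) ((hsf.mul_left _).add (hs2.mul_left _))
    calc f (t + 1) ^ 2 ≤ (f t + L * s t) ^ 2 := pow_le_pow_left₀ (hf _) (hstep t) 2
      _ = f t ^ 2 + (2 * L * (s t * f t) + L ^ 2 * s t ^ 2) := by ring
  have hfl : Tendsto f atTop (𝓝 (√l)) :=
    ((Real.continuous_sqrt.tendsto l).comp hl).congr fun t => Real.sqrt_sq (hf t)
  rcases (Real.sqrt_nonneg l).eq_or_lt with hzero | hpos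
  · rwa [← hzero] at hfl
  · refine absurd ?_ hsum
    obtain ⟨T, hT⟩ := eventually_atTop.1 (hfl.eventually_const_lt (half_lt_self hpos))
    rw [← summable_nat_add_iff T]
    refine Summable.of_nonneg_of_le (fun t => hs _) (fun t => ?_)
      (((summable_nat_add_iff T).2 hsf).mul_left (2 / √l))
    calc s (t + T) = 2 / √l * (s (t + T) * (√l / 2)) := by field_simp
      _ ≤ 2 / √l * (s (t + T) * f (t + T)) := by
          gcongr
          · exact hs _
          · exact (hT (t + T) (Nat.le_add_left _ _)).le

lemma le_of_le_mul_add {ε : ℕ → ℝ} {ρ c E : ℝ} (hρ : 0 ≤ ρ) (h0 : ε 0 ≤ E)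
    (hE : ρ * E + c ≤ E) (hstep : ∀ t, ε (t + 1) ≤ ρ * ε t + c) (t : ℕ) : ε t ≤ E := by
  induction t with
  | zero => exact h0
  | succ t ih => linarith [hstep t, mul_le_mul_of_nonneg_left ih hρ]

lemma sq_le_of_le_mul_add {a b q ρ : ℝ} (hρ0 : 0 ≤ ρ) (hρ1 : ρ < 1) (hb : 0 ≤ b)
    (h : b ≤ ρ * a + q) : b ^ 2 ≤ ρ * a ^ 2 + q ^ 2 / (1 - ρ) := by
  have hρ : 0 < 1 - ρ := sub_pos.2 hρ1
  calc b ^ 2 ≤ (ρ * a + q) ^ 2 := pow_le_pow_left₀ hb h 2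
    _ ≤ (ρ * a + q) ^ 2 + ρ / (1 - ρ) * ((1 - ρ) * a - q) ^ 2 :=
        le_add_of_nonneg_right (by positivity)
    _ = ρ * a ^ 2 + q ^ 2 / (1 - ρ) := by
        field_simp
        ring

lemma sum_sq_le_of_le_mul_add {ε q : ℕ → ℝ} {ρ : ℝ} (hρ0 : 0 ≤ ρ) (hρ1 : ρ < 1)
    (hε : ∀ t, 0 ≤ ε t) (hstep : ∀ t, ε (t + 1) ≤ ρ * ε t + q t) (T : ℕ) :
    (1 - ρ) * ∑ t ∈ range T, ε t ^ 2 ≤ ε 0 ^ 2 + ∑ t ∈ range T, q t ^ 2 / (1 - ρ) := by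
  suffices h : (1 - ρ) * ∑ t ∈ range T, ε t ^ 2 + ε T ^ 2 ≤
      ε 0 ^ 2 + ∑ t ∈ range T, q t ^ 2 / (1 - ρ) by linarith [sq_nonneg (ε T)]
  induction T with
  | zero => simp
  | succ T ih =>
    rw [sum_range_succ, sum_range_succ]
    linarith [sq_le_of_le_mul_add hρ0 hρ1 (hε _) (hstep T)]

/-! ### Dynamic average consensus -/

section Consensus

variable {ι F : Type*} [Fintype ι] [NormedAddCommGroup F] [NormedSpace ℝ F]

/-- The average of a family of vectors, as a linear map. -/
noncomputable def mean (ι F : Type*) [Fintype ι] [NormedAddCommGroup F] [NormedSpace ℝ F] :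
    (ι → F) →ₗ[ℝ] F :=
  (Fintype.card ι : ℝ)⁻¹ • ∑ i, LinearMap.proj i

/-- The disagreement `i ↦ x i - mean x` of a family of vectors, as a linear map. -/
noncomputable def disagreement (ι F : Type*) [Fintype ι] [NormedAddCommGroup F]
    [NormedSpace ℝ F] : (ι → F) →ₗ[ℝ] (ι → F) :=
  LinearMap.id - LinearMap.pi fun _ => mean ι F

lemma mean_apply (x : ι → F) : mean ι F x = (Fintype.card ι : ℝ)⁻¹ • ∑ i, x i := by
  simp [mean]

lemma disagreement_apply (x : ι → F) (i : ι) : disagreement ι F x i = x i - mean ι F x := rfl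

lemma norm_mean_le (x : ι → F) : ‖mean ι F x‖ ≤ ‖x‖ := by
  rw [mean_apply, norm_smul, norm_inv, RCLike.norm_natCast]
  refine inv_mul_le_of_le_mul₀ (by positivity) (norm_nonneg x) ?_
  calc ‖∑ i, x i‖ ≤ ∑ i, ‖x i‖ := norm_sum_le _ _
    _ ≤ Fintype.card ι * ‖x‖ := by
        simpa using sum_le_card_nsmul univ _ _ fun i _ => norm_le_pi_norm x i

lemma norm_disagreement_le (x : ι → F) : ‖disagreement ι F x‖ ≤ 2 * ‖x‖ := by
  refine (pi_norm_le_iff_of_nonneg (by positivity)).2 fun i => ?_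
  rw [disagreement_apply]
  linarith [norm_sub_le (x i) (mean ι F x), norm_le_pi_norm x i, norm_mean_le x]

lemma sum_disagreement (x : ι → F) : ∑ i, disagreement ι F x i = 0 := by
  rcases isEmpty_or_nonempty ι with _ | _
  · simp
  · have hcard : (Fintype.card ι : ℝ) ≠ 0 := by positivity
    simp only [disagreement_apply, sum_sub_distrib, sum_const, card_univ, mean_apply,
      ← Nat.cast_smul_eq_nsmul ℝ, smul_inv_smul₀ hcard, sub_self]

variable [DecidableEq ι] {A W : Matrix ι ι ℝ}

lemma norm_smul_le_of_mem_rowStochastic (hA : A ∈ Matrix.rowStochastic ℝ ι) {δ : ℝ}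
    (hδ : ∀ i j, δ ≤ A i j) {x : ι → F} (hx : ∑ i, x i = 0) :
    ‖A • x‖ ≤ (1 - Fintype.card ι * δ) * ‖x‖ := by
  rcases isEmpty_or_nonempty ι with _ | _
  · simp [Subsingleton.elim x 0]
  refine (pi_norm_le_iff_of_nonempty _).2 fun i => ?_
  -- Subtracting the constant `δ` from the entries does not change the action on zero-sum vectors.
  have hshift : (A • x) i = ∑ j, (A i j - δ) • x j := by
    simp [Matrix.Module.smul_apply, sub_smul, ← smul_sum, hx]
  calc ‖(A • x) i‖ ≤ ∑ j, (A i j - δ) * ‖x‖ := by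
        rw [hshift]
        refine norm_sum_le_of_le _ fun j _ => ?_
        rw [norm_smul, Real.norm_of_nonneg (sub_nonneg.2 (hδ i j))]
        exact mul_le_mul_of_nonneg_left (norm_le_pi_norm x j) (sub_nonneg.2 (hδ i j))
    _ = (1 - Fintype.card ι * δ) * ‖x‖ := by
        simp [← sum_mul, sum_sub_distrib, Matrix.sum_row_of_mem_rowStochastic hA i]

lemma norm_smul_le_norm_of_mem_rowStochastic (hA : A ∈ Matrix.rowStochastic ℝ ι) (x : ι → F) :
    ‖A • x‖ ≤ ‖x‖ := by
  refine (pi_norm_le_iff_of_nonneg (norm_nonneg x)).2 fun i => ?_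
  calc ‖(A • x) i‖ ≤ ∑ j, A i j * ‖x‖ := by
        rw [Matrix.Module.smul_apply]
        refine norm_sum_le_of_le _ fun j _ => ?_
        rw [norm_smul, Real.norm_of_nonneg (Matrix.nonneg_of_mem_rowStochastic hA)]
        exact mul_le_mul_of_nonneg_left (norm_le_pi_norm x j)
          (Matrix.nonneg_of_mem_rowStochastic hA)
    _ = ‖x‖ := by rw [← sum_mul, Matrix.sum_row_of_mem_rowStochastic hA, one_mul]

lemma mean_smul (hW : W ∈ doublyStochastic ℝ ι) (x : ι → F) : mean ι F (W • x) = mean ι F x := by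
  simp only [mean_apply, Matrix.Module.smul_apply]
  rw [sum_comm]
  simp only [← sum_smul, sum_col_of_mem_doublyStochastic hW, one_smul]

lemma disagreement_smul (hW : W ∈ doublyStochastic ℝ ι) (x : ι → F) :
    disagreement ι F (W • x) = W • disagreement ι F x := by
  ext i
  simp [disagreement_apply, mean_smul hW, Matrix.Module.smul_apply, smul_sub, sum_sub_distrib,
    ← sum_smul, sum_row_of_mem_doublyStochastic hW]

end Consensus

section AdaptedNorm

variable {M E : Type*} [Monoid M] [NormedAddCommGroup E] [DistribMulAction M E]
  {g : M} {ρ : ℝ} {m : ℕ}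

/-- The weighted sum `∑ j < m, ρ⁻ʲ ‖gʲ x‖` of the norms along an orbit. If `gᵐ` contracts by `ρᵐ`,
then `g` contracts this norm by `ρ` in a single step. -/
noncomputable def adaptedNorm (g : M) (ρ : ℝ) (m : ℕ) (x : E) : ℝ :=
  ∑ j ∈ range m, (ρ ^ j)⁻¹ * ‖g ^ j • x‖

lemma adaptedNorm_add_le (hρ : 0 ≤ ρ) (x z : E) :
    adaptedNorm g ρ m (x + z) ≤ adaptedNorm g ρ m x + adaptedNorm g ρ m z := by
  rw [adaptedNorm, adaptedNorm, adaptedNorm, ← sum_add_distrib]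
  refine sum_le_sum fun j _ => ?_
  rw [smul_add, ← mul_add]
  gcongr
  exact norm_add_le _ _

lemma norm_le_adaptedNorm (hρ : 0 ≤ ρ) (hm : 0 < m) (x : E) : ‖x‖ ≤ adaptedNorm g ρ m x :=
  calc ‖x‖ = (ρ ^ 0)⁻¹ * ‖g ^ 0 • x‖ := by simp
    _ ≤ adaptedNorm g ρ m x :=
        single_le_sum (f := fun j => (ρ ^ j)⁻¹ * ‖g ^ j • x‖) (fun j _ => by positivity)
          (mem_range.2 hm)

lemma adaptedNorm_le (hρ : 0 ≤ ρ) {x : E} (hg : ∀ j, ‖g ^ j • x‖ ≤ ‖x‖) :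
    adaptedNorm g ρ m x ≤ (∑ j ∈ range m, (ρ ^ j)⁻¹) * ‖x‖ := by
  rw [adaptedNorm, sum_mul]
  gcongr with j
  exact hg j

lemma adaptedNorm_smul_le (hρ : 0 < ρ) {x : E} (hg : ‖g ^ m • x‖ ≤ ρ ^ m * ‖x‖) :
    adaptedNorm g ρ m (g • x) ≤ ρ * adaptedNorm g ρ m x := by
  have hshift : adaptedNorm g ρ m (g • x) =
      ρ * ∑ j ∈ range m, (ρ ^ (j + 1))⁻¹ * ‖g ^ (j + 1) • x‖ := by
    rw [adaptedNorm, mul_sum]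
    refine sum_congr rfl fun j _ => ?_
    rw [smul_smul, ← pow_succ, pow_succ ρ]
    field_simp
  have hlast : (ρ ^ m)⁻¹ * ‖g ^ m • x‖ ≤ ‖x‖ := (inv_mul_le_iff₀ (by positivity)).2 hg
  rw [hshift, adaptedNorm]
  refine mul_le_mul_of_nonneg_left ?_ hρ.le
  have htele := sum_range_succ' (fun j => (ρ ^ j)⁻¹ * ‖g ^ j • x‖) m
  rw [sum_range_succ, pow_zero, pow_zero, inv_one, one_mul, one_smul] at htele
  linarith

end AdaptedNorm

section Tracking

variable {ι F : Type*} [Fintype ι] [DecidableEq ι] [NormedAddCommGroup F] [NormedSpace ℝ F]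
  {W : Matrix ι ι ℝ}

lemma exists_pow_ge_one_sub {θ : ℝ} (hθ0 : 0 < θ) (hθ1 : θ ≤ 1) {m : ℕ} (hm : 0 < m) :
    ∃ ρ : ℝ, 0 < ρ ∧ ρ < 1 ∧ 1 - θ ≤ ρ ^ m := by
  have hm1 : (1 : ℝ) ≤ m := by exact_mod_cast hm
  have hsmall : θ / 2 / m ≤ 1 / 2 := (div_le_self (by positivity) hm1).trans (by linarith)
  have hpos : 0 < θ / 2 / m := by positivity
  refine ⟨1 + -(θ / 2 / m), by linarith, by linarith, ?_⟩
  calc 1 - θ ≤ 1 + m * -(θ / 2 / m) := by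
        field_simp
        linarith
    _ ≤ (1 + -(θ / 2 / m)) ^ m := one_add_mul_le_pow (by linarith) m

lemma exists_contraction_rate_of_isPrimitive [Nonempty ι] (F : Type*) [NormedAddCommGroup F]
    [NormedSpace ℝ F] (hW : W ∈ Matrix.rowStochastic ℝ ι) (hprim : W.IsPrimitive) :
    ∃ m > 0, ∃ ρ : ℝ, 0 < ρ ∧ ρ < 1 ∧
      ∀ x : ι → F, ∑ i, x i = 0 → ‖W ^ m • x‖ ≤ ρ ^ m * ‖x‖ := by
  obtain ⟨m, hm, hpos⟩ := hprim.exists_pos_pow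
  have hWm : W ^ m ∈ Matrix.rowStochastic ℝ ι := pow_mem hW m
  obtain ⟨⟨a, b⟩, hmin⟩ := Finite.exists_min fun p : ι × ι => (W ^ m) p.1 p.2
  have hcard : Fintype.card ι * (W ^ m) a b ≤ 1 := by
    rw [← Matrix.sum_row_of_mem_rowStochastic hWm a, ← nsmul_eq_mul, ← card_univ]
    exact card_nsmul_le_sum _ _ _ fun j _ => hmin (a, j)
  have hpos_ab := hpos a b
  obtain ⟨ρ, hρ0, hρ1, hρ⟩ := exists_pow_ge_one_sub (by positivity) hcard hm
  refine ⟨m, hm, ρ, hρ0, hρ1, fun x hx => ?_⟩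
  exact (norm_smul_le_of_mem_rowStochastic hWm (fun i j => hmin (i, j)) hx).trans (by gcongr)

lemma mean_eq_of_consensus_recursion (hW : W ∈ doublyStochastic ℝ ι) {u e : ℕ → ι → F}
    (h0 : e 0 = u 0) (hsucc : ∀ t, e (t + 1) = W • e t + (u (t + 1) - u t)) (t : ℕ) :
    mean ι F (e t) = mean ι F (u t) := by
  induction t with
  | zero => rw [h0]
  | succ t ih => rw [hsucc, map_add, map_sub, mean_smul hW, ih, add_sub_cancel]

theorem exists_consensus_tracking_bound [Nonempty ι] (F : Type*) [NormedAddCommGroup F]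
    [NormedSpace ℝ F] (hW : W ∈ doublyStochastic ℝ ι) (hprim : W.IsPrimitive) :
    ∃ ρ K : ℝ, 0 ≤ ρ ∧ ρ < 1 ∧ 0 ≤ K ∧ ∀ u e : ℕ → ι → F, e 0 = u 0 →
      (∀ t, e (t + 1) = W • e t + (u (t + 1) - u t)) →
      ∃ ε : ℕ → ℝ, (∀ t, ‖e t - fun _ => mean ι F (u t)‖ ≤ ε t) ∧ ε 0 ≤ K * ‖u 0‖ ∧
        ∀ t, ε (t + 1) ≤ ρ * ε t + K * ‖u (t + 1) - u t‖ := by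
  -- Only some power of `W` need contract the disagreement, hence the adapted norm.
  have hrow := (mem_doublyStochastic_iff_mem_rowStochastic_and_mem_colStochastic.1 hW).1
  obtain ⟨m, hm, ρ, hρ0, hρ1, hcontr⟩ := exists_contraction_rate_of_isPrimitive F hrow hprim
  set C : ℝ := ∑ j ∈ range m, (ρ ^ j)⁻¹
  have hC : 0 ≤ C := sum_nonneg fun j _ => by positivity
  have hbound : ∀ x : ι → F, adaptedNorm W ρ m (disagreement ι F x) ≤ C * 2 * ‖x‖ := fun x =>
    calc adaptedNorm W ρ m (disagreement ι F x) ≤ C * ‖disagreement ι F x‖ :=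
          adaptedNorm_le hρ0.le fun j => norm_smul_le_norm_of_mem_rowStochastic (pow_mem hrow j) _
      _ ≤ C * (2 * ‖x‖) := by
          gcongr
          exact norm_disagreement_le x
      _ = C * 2 * ‖x‖ := by ring
  refine ⟨ρ, C * 2, hρ0.le, hρ1, by positivity, fun u e h0 hsucc =>
    ⟨fun t => adaptedNorm W ρ m (disagreement ι F (e t)), fun t => ?_, ?_, fun t => ?_⟩⟩
  · rw [← mean_eq_of_consensus_recursion hW h0 hsucc t]
    exact norm_le_adaptedNorm hρ0.le hm (disagreement ι F (e t))
  · simpa only [h0] using hbound (u 0)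
  · simp only [hsucc, map_add, disagreement_smul hW]
    exact (adaptedNorm_add_le hρ0.le _ _).trans
      (add_le_add (adaptedNorm_smul_le hρ0 (hcontr _ (sum_disagreement _))) (hbound _))

end Tracking

/-! ### Subgradients of bounded slope -/

/-- `f'` is a selection of subgradients of `f` on `S`, with slope at most `L` in the directions
that stay in `S`; the components of `f'` pointing out of `S` are left free. -/
structure IsLipschitzSubgradient {E : Type*} [NormedAddCommGroup E] [InnerProductSpace ℝ E]
    (S : Set E) (L : ℝ) (f : E → ℝ) (f' : E → E) : Prop where
  nonneg : 0 ≤ L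
  inner_le : ∀ ⦃x⦄, x ∈ S → ∀ ⦃p⦄, p ∈ S → ⟪f' x, p - x⟫ ≤ f p - f x
  neg_inner_le : ∀ ⦃x⦄, x ∈ S → ∀ ⦃p⦄, p ∈ S → -⟪f' x, p - x⟫ ≤ L * ‖p - x‖

section Subgradient

variable {E : Type*} [NormedAddCommGroup E] [InnerProductSpace ℝ E] {S : Set E} {L : ℝ}
  {f : E → ℝ} {f' : E → E} {x p : E}

namespace IsLipschitzSubgradient

lemma sub_le (h : IsLipschitzSubgradient S L f f') (hx : x ∈ S) (hp : p ∈ S) :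
    f p - f x ≤ L * ‖p - x‖ := by
  have hinner := h.inner_le hp hx
  have hslope := h.neg_inner_le hp hx
  rw [norm_sub_rev] at hslope
  linarith

lemma abs_sub_le (h : IsLipschitzSubgradient S L f f') (hx : x ∈ S) (hp : p ∈ S) :
    |f p - f x| ≤ L * ‖p - x‖ :=
  abs_sub_le_iff.2 ⟨h.sub_le hx hp, norm_sub_rev p x ▸ h.sub_le hp hx⟩

lemma abs_inner_le (h : IsLipschitzSubgradient S L f f') (hx : x ∈ S) (hp : p ∈ S) :
    |⟪f' x, p - x⟫| ≤ L * ‖p - x‖ :=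
  abs_le'.2 ⟨(h.inner_le hx hp).trans (h.sub_le hx hp), h.neg_inner_le hx hp⟩

lemma continuousOn (h : IsLipschitzSubgradient S L f f') : ContinuousOn f S :=
  (LipschitzOnWith.of_dist_le_mul (K := ⟨L, h.nonneg⟩) fun p hp x hx => by
    rw [Real.dist_eq, dist_eq_norm]
    exact h.abs_sub_le hx hp).continuousOn

lemma add {L₁ L₂ : ℝ} {f₁ f₂ : E → ℝ} {f₁' f₂' : E → E} (h₁ : IsLipschitzSubgradient S L₁ f₁ f₁')
    (h₂ : IsLipschitzSubgradient S L₂ f₂ f₂') :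
    IsLipschitzSubgradient S (L₁ + L₂) (fun x => f₁ x + f₂ x) (fun x => f₁' x + f₂' x) where
  nonneg := add_nonneg h₁.nonneg h₂.nonneg
  inner_le x hx p hp := by
    rw [inner_add_left]
    linarith [h₁.inner_le hx hp, h₂.inner_le hx hp]
  neg_inner_le x hx p hp := by
    rw [inner_add_left]
    linarith [h₁.neg_inner_le hx hp, h₂.neg_inner_le hx hp]

lemma sum {α : Type*} {s : Finset α} {L : α → ℝ} {f : α → E → ℝ} {f' : α → E → E}
    (h : ∀ a ∈ s, IsLipschitzSubgradient S (L a) (f a) (f' a)) :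
    IsLipschitzSubgradient S (∑ a ∈ s, L a) (fun x => ∑ a ∈ s, f a x)
      (fun x => ∑ a ∈ s, f' a x) where
  nonneg := sum_nonneg fun a ha => (h a ha).nonneg
  inner_le x hx p hp := by
    rw [sum_inner, ← sum_sub_distrib]
    exact sum_le_sum fun a ha => (h a ha).inner_le hx hp
  neg_inner_le x hx p hp := by
    rw [sum_inner, ← sum_neg_distrib, sum_mul]
    exact sum_le_sum fun a ha => (h a ha).neg_inner_le hx hp

lemma const_mul (h : IsLipschitzSubgradient S L f f') {c : ℝ} (hc : 0 ≤ c) :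
    IsLipschitzSubgradient S (c * L) (fun x => c * f x) (fun x => c • f' x) where
  nonneg := mul_nonneg hc h.nonneg
  inner_le x hx p hp := by
    rw [real_inner_smul_left, ← mul_sub]
    exact mul_le_mul_of_nonneg_left (h.inner_le hx hp) hc
  neg_inner_le x hx p hp := by
    rw [real_inner_smul_left, ← mul_neg, mul_assoc]
    exact mul_le_mul_of_nonneg_left (h.neg_inner_le hx hp) hc

lemma half_sq_max_zero (h : IsLipschitzSubgradient S L f f') {M : ℝ} (hM : 0 ≤ M)
    (hfM : ∀ x ∈ S, f x ≤ M) :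
    IsLipschitzSubgradient S (M * L) (fun x => max 0 (f x) ^ 2 / 2)
      (fun x => max 0 (f x) • f' x) where
  nonneg := mul_nonneg hM h.nonneg
  inner_le x hx p hp := by
    have hpos : 0 ≤ max 0 (f x) := le_max_left _ _
    have hself : max 0 (f x) * f x = max 0 (f x) ^ 2 := by
      rcases max_cases 0 (f x) with ⟨heq, _⟩ | ⟨heq, _⟩ <;> rw [heq] <;> ring
    have hle : max 0 (f x) * f p ≤ max 0 (f x) * max 0 (f p) :=
      mul_le_mul_of_nonneg_left (le_max_right _ _) hpos
    rw [real_inner_smul_left]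
    linarith [mul_le_mul_of_nonneg_left (h.inner_le hx hp) hpos,
      two_mul_le_add_sq (max 0 (f x)) (max 0 (f p))]
  neg_inner_le x hx p hp := by
    rw [real_inner_smul_left, ← mul_neg, mul_assoc]
    have hslope : 0 ≤ L * ‖p - x‖ := mul_nonneg h.nonneg (norm_nonneg _)
    calc max 0 (f x) * -⟪f' x, p - x⟫ ≤ max 0 (f x) * (L * ‖p - x‖) :=
          mul_le_mul_of_nonneg_left (h.neg_inner_le hx hp) (le_max_left _ _)
      _ ≤ M * (L * ‖p - x‖) := mul_le_mul_of_nonneg_right (max_le hM (hfM x hx)) hslope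

end IsLipschitzSubgradient

variable [CompleteSpace E]

lemma inner_gradient_le_of_forall_le (hS : Convex ℝ S) {v : E} (hx : x ∈ S)
    (hp : p ∈ S) (hf : HasGradientWithinAt f v S x) {c : ℝ}
    (hc : ∀ s ∈ Set.Ioc (0 : ℝ) 1, f (x + s • (p - x)) - f x ≤ s * c) : ⟪v, p - x⟫ ≤ c := by
  have hmem : ∀ s ∈ Set.Icc (0 : ℝ) 1, x + s • (p - x) ∈ S := fun s hs =>
    hS.add_smul_sub_mem hx hp hs
  have hline : HasDerivWithinAt (fun s : ℝ => x + s • (p - x)) (p - x) (Set.Icc 0 1) 0 := by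
    simpa using (((hasDerivAt_id (0 : ℝ)).smul_const (p - x)).const_add x).hasDerivWithinAt
  have hderiv : HasDerivWithinAt (fun s : ℝ => f (x + s • (p - x))) ⟪v, p - x⟫ (Set.Icc 0 1) 0 := by
    have hf' : HasFDerivWithinAt f (InnerProductSpace.toDual ℝ E v) S (x + (0 : ℝ) • (p - x)) := by
      simpa using hf.hasFDerivWithinAt
    rw [← InnerProductSpace.toDual_apply_apply (𝕜 := ℝ)]
    exact hf'.comp_hasDerivWithinAt (0 : ℝ) hline hmem
  rw [hasDerivWithinAt_iff_tendsto_slope, Set.Icc_sdiff_left] at hderiv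
  have : (𝓝[Set.Ioc (0 : ℝ) 1] 0).NeBot := by
    rw [nhdsWithin_Ioc_eq_nhdsGT zero_lt_one]
    infer_instance
  refine le_of_tendsto hderiv ?_
  filter_upwards [self_mem_nhdsWithin] with s hs
  rw [slope_def_field, sub_zero, div_le_iff₀ hs.1]
  simpa [mul_comm] using hc s hs

lemma isLipschitzSubgradient_of_hasGradientWithinAt {L : NNReal}
    (hconv : ConvexOn ℝ S f) (hlip : LipschitzOnWith L f S)
    (hgrad : ∀ x ∈ S, HasGradientWithinAt f (f' x) S x) : IsLipschitzSubgradient S L f f' where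
  nonneg := L.2
  inner_le x hx p hp := by
    refine inner_gradient_le_of_forall_le hconv.1 hx hp (hgrad x hx) fun s hs => ?_
    have hconvex := hconv.2 hx hp (sub_nonneg.2 hs.2) hs.1.le (sub_add_cancel 1 s)
    have hpoint : (1 - s) • x + s • p = x + s • (p - x) := by module
    rw [hpoint, smul_eq_mul, smul_eq_mul] at hconvex
    linarith
  neg_inner_le x hx p hp := by
    have hneg : HasGradientWithinAt (fun x => -f x) (-f' x) S x := by
      rw [hasGradientWithinAt_iff_hasFDerivWithinAt, map_neg]
      exact (hgrad x hx).hasFDerivWithinAt.neg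
    rw [← inner_neg_left]
    refine inner_gradient_le_of_forall_le hconv.1 hx hp hneg fun s hs => ?_
    have hdist := hlip.dist_le_mul x hx _ (hconv.1.add_smul_sub_mem hx hp ⟨hs.1.le, hs.2⟩)
    rw [Real.dist_eq, dist_self_add_right, norm_smul, Real.norm_of_nonneg hs.1.le] at hdist
    linarith [le_abs_self (f x - f (x + s • (p - x)))]

end Subgradient

/-! ### The penalized objective -/

section Objective

variable {ι κ : Type*} {n : ι → ℕ} {G : ∀ i, Set (EuclideanSpace ℝ (Fin (n i)))}
  {φ : ∀ i, EuclideanSpace ℝ (Fin (n i)) → ℝ}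
  {gradφ : ∀ i, EuclideanSpace ℝ (Fin (n i)) → EuclideanSpace ℝ (Fin (n i))}
  {g : ∀ i, κ → EuclideanSpace ℝ (Fin (n i)) → ℝ}
  {gradg : ∀ i, κ → EuclideanSpace ℝ (Fin (n i)) → EuclideanSpace ℝ (Fin (n i))}
  {μ : ℝ} {Lφ : ι → ℝ} {Lg : ι → κ → ℝ}

lemma feasibleSet_eq_preimage_pi : feasibleSet G = WithLp.ofLp ⁻¹' Set.univ.pi G := by
  ext y
  simp [feasibleSet]

lemma isCompact_feasibleSet (hG : ∀ i, IsCompact (G i)) : IsCompact (feasibleSet G) := by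
  have himage : feasibleSet G = WithLp.toLp 2 '' Set.univ.pi G := by
    rw [feasibleSet_eq_preimage_pi]
    exact ((WithLp.equiv 2 _).image_symm_eq_preimage _).symm
  rw [himage]
  exact (isCompact_univ_pi hG).image (PiLp.continuous_toLp 2 _)

lemma convex_feasibleSet (hG : ∀ i, Convex ℝ (G i)) : Convex ℝ (feasibleSet G) := by
  rw [feasibleSet_eq_preimage_pi]
  exact (convex_pi fun i _ => hG i).linear_preimage (WithLp.linearEquiv 2 ℝ _).toLinearMap

variable [Fintype ι]

lemma IsLipschitzSubgradient.separable {f : ∀ i, EuclideanSpace ℝ (Fin (n i)) → ℝ}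
    {f' : ∀ i, EuclideanSpace ℝ (Fin (n i)) → EuclideanSpace ℝ (Fin (n i))} {L : ι → ℝ}
    (h : ∀ i, IsLipschitzSubgradient (G i) (L i) (f i) (f' i)) :
    IsLipschitzSubgradient (feasibleSet G) (∑ i, L i) (fun y : Decision n => ∑ i, f i (y i))
      (fun y => WithLp.toLp 2 fun i => f' i (y i)) where
  nonneg := sum_nonneg fun i _ => (h i).nonneg
  inner_le x hx p hp := by
    rw [PiLp.inner_apply, ← sum_sub_distrib]
    exact sum_le_sum fun i _ => (h i).inner_le (hx i) (hp i)
  neg_inner_le x hx p hp := by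
    rw [PiLp.inner_apply, ← sum_neg_distrib, sum_mul]
    refine sum_le_sum fun i _ => ((h i).neg_inner_le (hx i) (hp i)).trans ?_
    exact mul_le_mul_of_nonneg_left (PiLp.norm_apply_le (p - x) i) (h i).nonneg

lemma isLipschitzSubgradient_globalConstraint
    (hg : ∀ i k, IsLipschitzSubgradient (G i) (Lg i k) (g i k) (gradg i k)) (k : κ) :
    IsLipschitzSubgradient (feasibleSet G) (∑ i, Lg i k) (globalConstraint g k)
      (fun y => WithLp.toLp 2 fun i => gradg i k (y i)) :=
  .separable fun i => hg i k

variable [Fintype κ]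

/-- The gradient `∇Φ(y)` of the penalized objective, assembled from gradients (or subgradients) of
the `φ_i` and `g_{i,k}`. -/
noncomputable def penalizedGradient
    (gradφ : ∀ i, EuclideanSpace ℝ (Fin (n i)) → EuclideanSpace ℝ (Fin (n i)))
    (g : ∀ i, κ → EuclideanSpace ℝ (Fin (n i)) → ℝ)
    (gradg : ∀ i, κ → EuclideanSpace ℝ (Fin (n i)) → EuclideanSpace ℝ (Fin (n i)))
    (μ : ℝ) (y : Decision n) : Decision n :=
  WithLp.toLp 2 (fun i => gradφ i (y i)) + (μ / Fintype.card ι) •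
    ∑ k, max 0 (globalConstraint g k y) • WithLp.toLp 2 fun i => gradg i k (y i)

lemma exists_isLipschitzSubgradient_penalizedObjective (hG : ∀ i, IsCompact (G i))
    (hφ : ∀ i, IsLipschitzSubgradient (G i) (Lφ i) (φ i) (gradφ i))
    (hg : ∀ i k, IsLipschitzSubgradient (G i) (Lg i k) (g i k) (gradg i k)) (hμ : 0 ≤ μ) :
    ∃ L, IsLipschitzSubgradient (feasibleSet G) L (penalizedObjective φ g μ)
      (penalizedGradient gradφ g gradg μ) := by
  have hglobal := isLipschitzSubgradient_globalConstraint hg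
  choose M hM using fun k => (isCompact_feasibleSet hG).exists_bound_of_continuousOn
    (hglobal k).continuousOn
  have hpenalty := IsLipschitzSubgradient.sum (s := univ) fun k _ =>
    (hglobal k).half_sq_max_zero (abs_nonneg (M k)) fun y hy =>
      (le_abs_self _).trans ((hM k y hy).trans (le_abs_self _))
  have hμN : 0 ≤ μ / Fintype.card ι := by positivity
  have hΦ : penalizedObjective φ g μ = fun y => ∑ i, φ i (y i) +
      μ / Fintype.card ι * ∑ k, max 0 (globalConstraint g k y) ^ 2 / 2 := by
    funext y
    rw [penalizedObjective, ← sum_div]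
    ring
  rw [hΦ]
  exact ⟨_, (IsLipschitzSubgradient.separable hφ).add (hpenalty.const_mul hμN)⟩

end Objective

/-! ### Inexact projected subgradient steps -/

section ProjectedSubgradient

variable {E : Type*} [NormedAddCommGroup E] [InnerProductSpace ℝ E] {S : Set E}

lemma IsEuclideanProj.inner_sub_le (hS : Convex ℝ S) {x p z : E} (h : IsEuclideanProj S x p)
    (hz : z ∈ S) : ⟪x - p, z - p⟫ ≤ 0 := by
  have : Nonempty S := ⟨⟨p, h.1⟩⟩
  refine (norm_eq_iInf_iff_real_inner_le_zero hS h.1).1 (le_antisymm ?_ ?_) z hz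
  · exact le_ciInf fun w => h.2 w w.2
  · exact ciInf_le ⟨0, Set.forall_mem_range.2 fun _ => norm_nonneg _⟩ (⟨p, h.1⟩ : S)

lemma IsEuclideanProj.norm_step_le (hS : Convex ℝ S) {x p U : E} {γ M : ℝ} (hγ : 0 ≤ γ)
    (hx : x ∈ S) (h : IsEuclideanProj S (x + γ • U) p) (hM : 0 ≤ M)
    (hU : ⟪U, p - x⟫ ≤ M * ‖p - x‖) : ‖p - x‖ ≤ γ * M := by
  have hvar : ‖p - x‖ ^ 2 ≤ γ * ⟪U, p - x⟫ := by
    have hproj := h.inner_sub_le hS hx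
    rw [show x + γ • U - p = γ • U - (p - x) by abel, show x - p = -(p - x) by abel,
      inner_neg_right, inner_sub_left, real_inner_self_eq_norm_sq, real_inner_smul_left] at hproj
    linarith
  rcases (norm_nonneg (p - x)).eq_or_lt with hzero | hpos
  · rw [← hzero]
    positivity
  · refine le_of_mul_le_mul_right ?_ hpos
    linarith [mul_le_mul_of_nonneg_left hU hγ]

lemma IsEuclideanProj.norm_sub_sq_le (hS : Convex ℝ S) {x p z U : E} {γ M : ℝ} (hγ : 0 ≤ γ)
    (hz : z ∈ S) (h : IsEuclideanProj S (x + γ • U) p) (hU : ⟪U, p - x⟫ ≤ M * ‖p - x‖) :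
    ‖p - z‖ ^ 2 ≤ ‖x - z‖ ^ 2 + 2 * γ * ⟪U, x - z⟫ + (γ * M) ^ 2 := by
  have hvar : ‖p - x‖ ^ 2 + ⟪p - x, x - z⟫ ≤ γ * ⟪U, x - z⟫ + γ * ⟪U, p - x⟫ := by
    have hproj := h.inner_sub_le hS hz
    rw [show x + γ • U - p = γ • U - (p - x) by abel,
      show z - p = -((p - x) + (x - z)) by abel, inner_neg_right, inner_sub_left,
      inner_add_right, inner_add_right, real_inner_self_eq_norm_sq, real_inner_smul_left,
      real_inner_smul_left] at hproj
    linarith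
  have hexpand : ‖p - z‖ ^ 2 = ‖p - x‖ ^ 2 + 2 * ⟪p - x, x - z⟫ + ‖x - z‖ ^ 2 := by
    rw [← norm_add_sq_real, sub_add_sub_cancel]
  linarith [mul_le_mul_of_nonneg_left hU hγ, two_mul_le_add_sq ‖p - x‖ (γ * M)]

lemma IsLipschitzSubgradient.inner_le_of_abs_inner_le {f : E → ℝ} {f' : E → E} {L b : ℝ}
    (hf : IsLipschitzSubgradient S L f f') {x U v p : E} (hx : x ∈ S) (hp : p ∈ S)
    (hU : |⟪U + f' x - v, p - x⟫| ≤ b * ‖p - x‖) : ⟪U, p - x⟫ ≤ (L + b + ‖v‖) * ‖p - x‖ := by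
  rw [inner_sub_left, inner_add_left] at hU
  linarith [(abs_le.1 hU).2, hf.neg_inner_le hx hp, real_inner_le_norm v (p - x)]

/-- A run of the projected subgradient method on `S` with step sizes `γ` and noise `V`: the update
direction is `-f' (y t) + V t` up to a bias of slope at most `ε t`, and the bias contracts at rate
`ρ` up to the length of the last step. Only the components of the bias that point into `S` are
constrained. -/
structure IsInexactSubgradientRun (S : Set E) (f' : E → E) (γ : ℕ → ℝ) (ρ c : ℝ)
    (V y : ℕ → E) (ε : ℕ → ℝ) : Prop where
  mem_zero : y 0 ∈ S
  proj : ∀ t, ∃ U, IsEuclideanProj S (y t + γ t • U) (y (t + 1)) ∧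
    ∀ p ∈ S, |⟪U + f' (y t) - V t, p - y t⟫| ≤ ε t * ‖p - y t‖
  bias_nonneg : ∀ t, 0 ≤ ε t
  bias_zero : ε 0 ≤ c
  bias_succ : ∀ t, ε (t + 1) ≤ ρ * ε t + c * ‖y (t + 1) - y t‖

namespace IsInexactSubgradientRun

variable {f : E → ℝ} {f' : E → E} {γ : ℕ → ℝ} {ρ c L : ℝ} {V y : ℕ → E} {ε : ℕ → ℝ}

lemma mem (h : IsInexactSubgradientRun S f' γ ρ c V y ε) (t : ℕ) : y t ∈ S := by
  cases t with
  | zero => exact h.mem_zero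
  | succ t =>
    obtain ⟨U, hproj, -⟩ := h.proj t
    exact hproj.1

lemma bias_le (h : IsInexactSubgradientRun S f' γ ρ c V y ε) (hρ0 : 0 ≤ ρ) (hρ1 : ρ < 1)
    (hS : Bornology.IsBounded S) (t : ℕ) : ε t ≤ c * (1 + Metric.diam S) / (1 - ρ) := by
  have hc : 0 ≤ c := (h.bias_nonneg 0).trans h.bias_zero
  have hD : 0 ≤ c * Metric.diam S := mul_nonneg hc Metric.diam_nonneg
  have hρ : 0 < 1 - ρ := sub_pos.2 hρ1
  set E := c * (1 + Metric.diam S) / (1 - ρ)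
  have hfix : (1 - ρ) * E = c * (1 + Metric.diam S) := mul_div_cancel₀ _ hρ.ne'
  have hE : 0 ≤ ρ * E := by positivity
  refine le_of_le_mul_add (c := c * Metric.diam S) hρ0 ?_ ?_ (fun s => ?_) t
  · linarith [h.bias_zero]
  · linarith
  · refine (h.bias_succ s).trans (add_le_add_right (mul_le_mul_of_nonneg_left ?_ hc) _)
    rw [← dist_eq_norm]
    exact Metric.dist_le_diam_of_mem hS (h.mem _) (h.mem _)

lemma norm_step_le (hS : Convex ℝ S) (hf : IsLipschitzSubgradient S L f f') (hγ : ∀ t, 0 ≤ γ t)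
    (h : IsInexactSubgradientRun S f' γ ρ c V y ε) (t : ℕ) :
    ‖y (t + 1) - y t‖ ≤ γ t * (L + ε t + ‖V t‖) := by
  obtain ⟨U, hproj, hbias⟩ := h.proj t
  have hL := hf.nonneg
  have hε := h.bias_nonneg t
  exact hproj.norm_step_le hS (hγ t) (h.mem t) (by positivity)
    (hf.inner_le_of_abs_inner_le (h.mem t) hproj.1 (hbias _ hproj.1))

lemma norm_sub_sq_succ_le (hS : Convex ℝ S) (hf : IsLipschitzSubgradient S L f f')
    (hγ : ∀ t, 0 ≤ γ t) (h : IsInexactSubgradientRun S f' γ ρ c V y ε) {z : E} (hz : z ∈ S)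
    (t : ℕ) :
    ‖y (t + 1) - z‖ ^ 2 ≤ ‖y t - z‖ ^ 2 +
      2 * (γ t * (f z - f (y t)) + γ t * ⟪V t, y t - z⟫ + γ t * (ε t * ‖y t - z‖)) +
      (γ t * (L + ε t + ‖V t‖)) ^ 2 := by
  obtain ⟨U, hproj, hbias⟩ := h.proj t
  have hdescent := hproj.norm_sub_sq_le hS (hγ t) hz
    (hf.inner_le_of_abs_inner_le (h.mem t) hproj.1 (hbias _ hproj.1))
  have hinner : ⟪U, y t - z⟫ ≤ f z - f (y t) + ⟪V t, y t - z⟫ + ε t * ‖y t - z‖ := by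
    have hbias_z := (abs_le.1 (hbias z hz)).1
    rw [inner_sub_left, inner_add_left, norm_sub_rev] at hbias_z
    rw [← neg_sub z (y t), inner_neg_right, inner_neg_right, norm_neg, norm_sub_rev]
    linarith [hf.inner_le (h.mem t) hz]
  linarith [mul_le_mul_of_nonneg_left hinner (hγ t)]

lemma sum_gap_le (hS : Convex ℝ S) (hb : Bornology.IsBounded S)
    (hf : IsLipschitzSubgradient S L f f') (hγ : ∀ t, 0 ≤ γ t)
    (h : IsInexactSubgradientRun S f' γ ρ c V y ε) {z : E} (hz : z ∈ S) (T : ℕ) :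
    2 * ∑ t ∈ range T, γ t * (f (y t) - f z) ≤
      Metric.diam S ^ 2 + 2 * ∑ t ∈ range T, γ t * ⟪V t, y t - z⟫ +
      2 * Metric.diam S * ∑ t ∈ range T, γ t * ε t +
      ∑ t ∈ range T, (γ t * (L + ε t + ‖V t‖)) ^ 2 := by
  have hD : ∀ t, ‖y t - z‖ ≤ Metric.diam S := fun t => by
    rw [← dist_eq_norm]
    exact Metric.dist_le_diam_of_mem hb (h.mem t) hz
  suffices hsum : ‖y T - z‖ ^ 2 + 2 * ∑ t ∈ range T, γ t * (f (y t) - f z) ≤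
      ‖y 0 - z‖ ^ 2 + 2 * ∑ t ∈ range T, γ t * ⟪V t, y t - z⟫ +
      2 * Metric.diam S * ∑ t ∈ range T, γ t * ε t +
      ∑ t ∈ range T, (γ t * (L + ε t + ‖V t‖)) ^ 2 by
    linarith [sq_nonneg ‖y T - z‖, pow_le_pow_left₀ (norm_nonneg _) (hD 0) 2]
  induction T with
  | zero => simp
  | succ T ih =>
    simp only [sum_range_succ]
    have hbias : γ T * (ε T * ‖y T - z‖) ≤ γ T * (ε T * Metric.diam S) :=
      mul_le_mul_of_nonneg_left (mul_le_mul_of_nonneg_left (hD T) (h.bias_nonneg T)) (hγ T)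
    linarith [h.norm_sub_sq_succ_le hS hf hγ hz T]

lemma sum_mul_bias_le (hρ0 : 0 ≤ ρ) (hρ1 : ρ < 1)
    (h : IsInexactSubgradientRun S f' γ ρ c V y ε) (T : ℕ) :
    ∑ t ∈ range T, γ t * ε t ≤ c ^ 2 / (1 - ρ) + ∑ t ∈ range T, γ t ^ 2 +
      (c / (1 - ρ)) ^ 2 * ∑ t ∈ range T, ‖y (t + 1) - y t‖ ^ 2 := by
  have hρ : 0 < 1 - ρ := sub_pos.2 hρ1
  have hsq : ∑ t ∈ range T, ε t ^ 2 ≤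
      c ^ 2 / (1 - ρ) + (c / (1 - ρ)) ^ 2 * ∑ t ∈ range T, ‖y (t + 1) - y t‖ ^ 2 := by
    have hcontr := sum_sq_le_of_le_mul_add hρ0 hρ1 h.bias_nonneg h.bias_succ T
    have hzero := pow_le_pow_left₀ (h.bias_nonneg 0) h.bias_zero 2
    simp only [mul_pow, mul_div_right_comm, ← mul_sum] at hcontr
    rw [← mul_le_mul_iff_right₀ hρ]
    refine hcontr.trans ((add_le_add_left hzero _).trans_eq ?_)
    field_simp
  have hyoung : ∑ t ∈ range T, γ t * ε t ≤ ∑ t ∈ range T, γ t ^ 2 + ∑ t ∈ range T, ε t ^ 2 := by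
    rw [← sum_add_distrib]
    exact sum_le_sum fun t _ => by
      linarith [two_mul_le_add_sq (γ t) (ε t), sq_nonneg (γ t), sq_nonneg (ε t)]
  linarith

lemma sum_gap_le_of_slope_le (hS : Convex ℝ S) (hb : Bornology.IsBounded S)
    (hf : IsLipschitzSubgradient S L f f') (hγ : ∀ t, 0 ≤ γ t) (hρ0 : 0 ≤ ρ) (hρ1 : ρ < 1)
    (h : IsInexactSubgradientRun S f' γ ρ c V y ε) {A : ℝ}
    (hA : ∀ t, γ t * (L + ε t + ‖V t‖) ≤ A * (γ t * (1 + ‖V t‖))) {z : E} (hz : z ∈ S) (T : ℕ) :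
    ∑ t ∈ range T, γ t * (f (y t) - f z) ≤
      Metric.diam S ^ 2 + Metric.diam S * (c ^ 2 / (1 - ρ)) +
      ∑ t ∈ range T, γ t * ⟪V t, y t - z⟫ +
      (Metric.diam S * (1 + (c / (1 - ρ)) ^ 2 * A ^ 2) + A ^ 2) *
        ∑ t ∈ range T, (γ t * (1 + ‖V t‖)) ^ 2 := by
  have hslope_nonneg : ∀ t, 0 ≤ γ t * (L + ε t + ‖V t‖) := fun t =>
    mul_nonneg (hγ t) (add_nonneg (add_nonneg hf.nonneg (h.bias_nonneg t)) (norm_nonneg _))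
  have hslope : ∑ t ∈ range T, (γ t * (L + ε t + ‖V t‖)) ^ 2 ≤
      A ^ 2 * ∑ t ∈ range T, (γ t * (1 + ‖V t‖)) ^ 2 := by
    simp only [mul_sum, ← mul_pow A]
    exact sum_le_sum fun t _ => pow_le_pow_left₀ (hslope_nonneg t) (hA t) 2
  have hstep : ∑ t ∈ range T, ‖y (t + 1) - y t‖ ^ 2 ≤
      A ^ 2 * ∑ t ∈ range T, (γ t * (1 + ‖V t‖)) ^ 2 :=
    (sum_le_sum fun t _ =>
      pow_le_pow_left₀ (norm_nonneg _) (h.norm_step_le hS hf hγ t) 2).trans hslope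
  have hweights : ∑ t ∈ range T, γ t ^ 2 ≤ ∑ t ∈ range T, (γ t * (1 + ‖V t‖)) ^ 2 :=
    sum_le_sum fun t _ => pow_le_pow_left₀ (hγ t)
      (le_mul_of_one_le_right (hγ t) (le_add_of_nonneg_right (norm_nonneg _))) 2
  have hbias := h.sum_mul_bias_le (γ := γ) hρ0 hρ1 T
  have hbias_step := mul_le_mul_of_nonneg_left hstep (sq_nonneg (c / (1 - ρ)))
  have hD : 0 ≤ Metric.diam S := Metric.diam_nonneg
  have hbias_sum := mul_le_mul_of_nonneg_left
    (hbias.trans (add_le_add (add_le_add_right hweights _) hbias_step)) hD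
  linarith [h.sum_gap_le hS hb hf hγ hz T, sq_nonneg (Metric.diam S),
    (sum_nonneg fun t _ => sq_nonneg _).trans hslope]

end IsInexactSubgradientRun

theorem exists_inexactSubgradientRun_bound {f : E → ℝ} {f' : E → E} {γ : ℕ → ℝ} {ρ c L : ℝ}
    (hS : Convex ℝ S) (hb : Bornology.IsBounded S) (hf : IsLipschitzSubgradient S L f f')
    (hγ : ∀ t, 0 ≤ γ t) (hρ0 : 0 ≤ ρ) (hρ1 : ρ < 1) (hc : 0 ≤ c) :
    ∃ B, 0 ≤ B ∧ ∀ V y ε, IsInexactSubgradientRun S f' γ ρ c V y ε →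
      (∀ t, ‖y (t + 1) - y t‖ ≤ B * (γ t * (1 + ‖V t‖))) ∧
      ∀ z ∈ S, ∀ T, ∑ t ∈ range T, γ t * (f (y t) - f z) ≤
        B + ∑ t ∈ range T, γ t * ⟪V t, y t - z⟫ +
        B * ∑ t ∈ range T, (γ t * (1 + ‖V t‖)) ^ 2 := by
  have hρ : 0 < 1 - ρ := sub_pos.2 hρ1
  have hL := hf.nonneg
  set A := L + c * (1 + Metric.diam S) / (1 - ρ) + 1
  have hA : 1 ≤ A := le_add_of_nonneg_left (by positivity)
  set B₁ := Metric.diam S ^ 2 + Metric.diam S * (c ^ 2 / (1 - ρ))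
  set B₂ := Metric.diam S * (1 + (c / (1 - ρ)) ^ 2 * A ^ 2) + A ^ 2
  have hB₁ : 0 ≤ B₁ := by positivity
  have hB₂ : 0 ≤ B₂ := by positivity
  refine ⟨A + B₁ + B₂, by positivity, fun V y ε h => ?_⟩
  have hslope : ∀ t, γ t * (L + ε t + ‖V t‖) ≤ A * (γ t * (1 + ‖V t‖)) := fun t => by
    rw [mul_left_comm]
    refine mul_le_mul_of_nonneg_left ?_ (hγ t)
    linarith [h.bias_le hρ0 hρ1 hb t, le_mul_of_one_le_left (norm_nonneg (V t)) hA]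
  have hR : ∀ t, 0 ≤ γ t * (1 + ‖V t‖) := fun t => mul_nonneg (hγ t) (by positivity)
  refine ⟨fun t => ?_, fun z hz T => ?_⟩
  · refine ((h.norm_step_le hS hf hγ t).trans (hslope t)).trans ?_
    exact mul_le_mul_of_nonneg_right (by linarith) (hR t)
  · refine (h.sum_gap_le_of_slope_le hS hb hf hγ hρ0 hρ1 hslope hz T).trans ?_
    exact add_le_add (add_le_add_left (by linarith) _)
      (mul_le_mul_of_nonneg_right (by linarith) (sum_nonneg fun t _ => sq_nonneg _))

end ProjectedSubgradient

/-! ### Stochastic descent -/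

section Minimizers

variable {X : Type*} [PseudoMetricSpace X] {S : Set X} {f : X → ℝ}

lemma exists_pos_add_le_of_le_infDist_minimizers (hS : IsCompact S) (hf : ContinuousOn f S)
    {z : X} (hmin : ∀ x ∈ S, f z ≤ f x) {δ : ℝ} (hδ : 0 < δ) :
    ∃ η > 0, ∀ x ∈ S, δ ≤ Metric.infDist x {x | x ∈ S ∧ ∀ w ∈ S, f x ≤ f w} → f z + η ≤ f x := by
  set A := {x | x ∈ S ∧ ∀ w ∈ S, f x ≤ f w}
  have hfar : IsCompact (S ∩ {x | δ ≤ Metric.infDist x A}) :=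
    hS.inter_right (isClosed_le continuous_const (Metric.continuous_infDist_pt A))
  rcases (S ∩ {x | δ ≤ Metric.infDist x A}).eq_empty_or_nonempty with hempty | hne
  · exact ⟨1, one_pos, fun x hx hfar => (hempty.subset ⟨hx, hfar⟩).elim⟩
  obtain ⟨x₀, ⟨hx₀, hx₀far⟩, hx₀min⟩ := hfar.exists_isMinOn hne (hf.mono Set.inter_subset_left)
  have hlt : f z < f x₀ := by
    refine lt_of_not_ge fun hle => hδ.not_ge (hx₀far.trans_eq ?_)
    exact Metric.infDist_zero_of_mem ⟨hx₀, fun w hw => hle.trans (hmin w hw)⟩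
  refine ⟨f x₀ - f z, sub_pos.2 hlt, fun x hx hfar => ?_⟩
  rw [add_sub_cancel]
  exact hx₀min ⟨hx, hfar⟩

lemma tendsto_infDist_minimizers (hS : IsCompact S) (hf : ContinuousOn f S) {z : X}
    (hmin : ∀ x ∈ S, f z ≤ f x) {y : ℕ → X} (hy : ∀ t, y t ∈ S)
    (hlim : Tendsto (fun t => f (y t) - f z) atTop (𝓝 0)) :
    Tendsto (fun t => Metric.infDist (y t) {x | x ∈ S ∧ ∀ w ∈ S, f x ≤ f w}) atTop (𝓝 0) := by
  refine tendsto_order.2 ⟨fun b hb => .of_forall fun t => hb.trans_le Metric.infDist_nonneg,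
    fun δ hδ => ?_⟩
  obtain ⟨η, hη, hfar⟩ := exists_pos_add_le_of_le_infDist_minimizers hS hf hmin hδ
  filter_upwards [hlim.eventually_lt_const hη] with t ht
  refine lt_of_not_ge fun hge => ?_
  linarith [hfar _ (hy t) hge]

end Minimizers

section Drift

variable {Ω : Type*} [MeasurableSpace Ω] {P : Measure Ω}

lemma ae_summable_of_summable_integral {X : ℕ → Ω → ℝ} (hX : ∀ t, Integrable (X t) P)
    (hX0 : ∀ᵐ ω ∂P, ∀ t, 0 ≤ X t ω) (hsum : Summable fun t => ∫ ω, X t ω ∂P) :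
    ∀ᵐ ω ∂P, Summable fun t => X t ω := by
  have hmeas : ∀ t, AEMeasurable (fun ω => ENNReal.ofReal (X t ω)) P := fun t =>
    (hX t).aestronglyMeasurable.aemeasurable.ennreal_ofReal
  have hfin : ∫⁻ ω, ∑' t, ENNReal.ofReal (X t ω) ∂P ≠ ⊤ := by
    rw [lintegral_tsum hmeas]
    simp only [← ofReal_integral_eq_lintegral_ofReal (hX _) ((ae_all_iff.1 hX0) _)]
    exact hsum.tsum_ofReal_ne_top
  filter_upwards [hX0, ae_lt_top' (AEMeasurable.tsum hmeas) hfin] with ω hω0 hω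
  simpa only [ENNReal.toReal_ofReal (hω0 _)] using ENNReal.summable_toReal hω.ne

variable [IsProbabilityMeasure P] {X R Z : ℕ → Ω → ℝ} {γ : ℕ → ℝ} {B C L : ℝ}

lemma integral_sum_drift_le (hB : 0 ≤ B) (hX_int : ∀ t, Integrable (X t) P)
    (hR_int : ∀ t, Integrable (fun ω => R t ω ^ 2) P) (hR_le : ∀ t, ∫ ω, R t ω ^ 2 ∂P ≤ C)
    (hZ_int : ∀ t, Integrable (Z t) P) (hZ : ∀ t, ∫ ω, Z t ω ∂P = 0) {T : ℕ}
    (hdrift : ∀ᵐ ω ∂P, ∑ t ∈ range T, γ t * X t ω ≤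
      B + ∑ t ∈ range T, γ t * Z t ω + B * ∑ t ∈ range T, (γ t * R t ω) ^ 2) :
    ∑ t ∈ range T, γ t * ∫ ω, X t ω ∂P ≤ B + B * ∑ t ∈ range T, γ t ^ 2 * C := by
  have hX_sum : Integrable (fun ω => ∑ t ∈ range T, γ t * X t ω) P :=
    integrable_finsetSum _ fun t _ => (hX_int t).const_mul _
  have hZ_sum : Integrable (fun ω => ∑ t ∈ range T, γ t * Z t ω) P :=
    integrable_finsetSum _ fun t _ => (hZ_int t).const_mul _
  have hR_sum : Integrable (fun ω => ∑ t ∈ range T, (γ t * R t ω) ^ 2) P := by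
    simp only [mul_pow]
    exact integrable_finsetSum _ fun t _ => (hR_int t).const_mul _
  have hBZ : Integrable (fun ω => B + ∑ t ∈ range T, γ t * Z t ω) P :=
    (integrable_const B).add hZ_sum
  calc ∑ t ∈ range T, γ t * ∫ ω, X t ω ∂P
      = ∫ ω, ∑ t ∈ range T, γ t * X t ω ∂P := by
        simp only [integral_finsetSum _ fun t _ => (hX_int t).const_mul (γ t), integral_const_mul]
    _ ≤ ∫ ω, B + ∑ t ∈ range T, γ t * Z t ω + B * ∑ t ∈ range T, (γ t * R t ω) ^ 2 ∂P :=
        integral_mono_ae hX_sum (hBZ.add (hR_sum.const_mul B)) hdrift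
    _ = B + B * ∑ t ∈ range T, γ t ^ 2 * ∫ ω, R t ω ^ 2 ∂P := by
        rw [integral_add hBZ (hR_sum.const_mul B), integral_add (integrable_const B) hZ_sum]
        simp only [mul_pow, integral_const_mul, integral_const, probReal_univ, one_smul, hZ,
          integral_finsetSum _ fun t _ => (hZ_int t).const_mul (γ t), mul_zero, sum_const_zero,
          integral_finsetSum _ fun t _ => (hR_int t).const_mul (γ t ^ 2), add_zero]
    _ ≤ B + B * ∑ t ∈ range T, γ t ^ 2 * C := by gcongr; exact hR_le _

lemma summable_mul_integral_of_drift (hγ : ∀ t, 0 ≤ γ t) (hγ_sq : Summable fun t => γ t ^ 2)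
    (hB : 0 ≤ B) (hX0 : ∀ᵐ ω ∂P, ∀ t, 0 ≤ X t ω) (hX_int : ∀ t, Integrable (X t) P)
    (hR_int : ∀ t, Integrable (fun ω => R t ω ^ 2) P) (hR_le : ∀ t, ∫ ω, R t ω ^ 2 ∂P ≤ C)
    (hZ_int : ∀ t, Integrable (Z t) P) (hZ : ∀ t, ∫ ω, Z t ω ∂P = 0)
    (hdrift : ∀ᵐ ω ∂P, ∀ T, ∑ t ∈ range T, γ t * X t ω ≤
      B + ∑ t ∈ range T, γ t * Z t ω + B * ∑ t ∈ range T, (γ t * R t ω) ^ 2) :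
    Summable fun t => γ t * ∫ ω, X t ω ∂P := by
  have hC : 0 ≤ C := (integral_nonneg fun ω => sq_nonneg (R 0 ω)).trans (hR_le 0)
  refine summable_of_sum_range_le (c := B + B * ∑' t, γ t ^ 2 * C)
    (fun t => mul_nonneg (hγ t) (integral_nonneg_of_ae ((ae_all_iff.1 hX0) t))) fun T => ?_
  refine (integral_sum_drift_le hB hX_int hR_int hR_le hZ_int hZ
    (hdrift.mono fun ω hω => hω T)).trans ?_
  gcongr
  exact (hγ_sq.mul_right C).sum_le_tsum _ fun t _ => mul_nonneg (sq_nonneg _) hC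

theorem ae_tendsto_zero_of_drift (hγ : ∀ t, 0 ≤ γ t) (hγ_sum : ¬ Summable γ)
    (hγ_sq : Summable fun t => γ t ^ 2) (hB : 0 ≤ B)
    (hX0 : ∀ᵐ ω ∂P, ∀ t, 0 ≤ X t ω) (hX_int : ∀ t, Integrable (X t) P)
    (hR1 : ∀ t ω, 1 ≤ R t ω) (hR_int : ∀ t, Integrable (fun ω => R t ω ^ 2) P)
    (hR_le : ∀ t, ∫ ω, R t ω ^ 2 ∂P ≤ C)
    (hXR_int : ∀ t, Integrable (fun ω => X t ω * R t ω) P)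
    (hXR_le : ∀ t, ∫ ω, X t ω * R t ω ∂P ≤ C * ∫ ω, X t ω ∂P)
    (hZ_int : ∀ t, Integrable (Z t) P) (hZ : ∀ t, ∫ ω, Z t ω ∂P = 0)
    (hdrift : ∀ᵐ ω ∂P, ∀ T, ∑ t ∈ range T, γ t * X t ω ≤
      B + ∑ t ∈ range T, γ t * Z t ω + B * ∑ t ∈ range T, (γ t * R t ω) ^ 2)
    (hstep : ∀ᵐ ω ∂P, ∀ t, X (t + 1) ω ≤ X t ω + L * (γ t * R t ω)) :
    ∀ᵐ ω ∂P, Tendsto (fun t => X t ω) atTop (𝓝 0) := by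
  have hR0 : ∀ t ω, 0 ≤ R t ω := fun t ω => zero_le_one.trans (hR1 t ω)
  have hs0 : ∀ t ω, 0 ≤ γ t * R t ω := fun t ω => mul_nonneg (hγ t) (hR0 t ω)
  have hX_sum : Summable fun t => γ t * ∫ ω, X t ω ∂P :=
    summable_mul_integral_of_drift hγ hγ_sq hB hX0 hX_int hR_int hR_le hZ_int hZ hdrift
  have hprod : ∀ᵐ ω ∂P, Summable fun t => γ t * (X t ω * R t ω) := by
    have hprod0 : ∀ᵐ ω ∂P, ∀ t, 0 ≤ γ t * (X t ω * R t ω) := hX0.mono fun ω hω t =>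
      mul_nonneg (hγ t) (mul_nonneg (hω t) (hR0 t ω))
    refine ae_summable_of_summable_integral (fun t => (hXR_int t).const_mul _) hprod0 ?_
    refine (hX_sum.mul_left C).of_nonneg_of_le
      (fun t => integral_nonneg_of_ae ((ae_all_iff.1 hprod0) t)) fun t => ?_
    rw [integral_const_mul, mul_left_comm]
    exact mul_le_mul_of_nonneg_left (hXR_le t) (hγ t)
  have hsq : ∀ᵐ ω ∂P, Summable fun t => (γ t * R t ω) ^ 2 := by
    simp only [mul_pow]
    refine ae_summable_of_summable_integral (fun t => (hR_int t).const_mul _)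
      (ae_of_all _ fun ω t => by positivity) ?_
    simp only [integral_const_mul]
    exact (hγ_sq.mul_right C).of_nonneg_of_le (fun t => by positivity) fun t =>
      mul_le_mul_of_nonneg_left (hR_le t) (sq_nonneg _)
  filter_upwards [hX0, hstep, hprod, hsq] with ω hω0 hωstep hωprod hωsq
  refine tendsto_zero_of_summable_mul hω0 (hs0 · ω) hωstep ?_ hωsq fun hsum => hγ_sum ?_
  · exact hωprod.congr fun t => by ring
  · exact hsum.of_nonneg_of_le hγ fun t => le_mul_of_one_le_right (hγ t) (hR1 t ω)

end Drift

section ConditionalNoise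

variable {Ω α β E : Type*} [MeasurableSpace Ω] [MeasurableSpace α] [MeasurableSpace β]
  {P : Measure Ω} [IsFiniteMeasure P] {y : Ω → α}

lemma integrable_mul_of_hasCondDistrib {ν : Kernel α β} [IsSFiniteKernel ν] {V : Ω → β}
    (h : HasCondDistrib V y ν P) {a : α → ℝ} {w : β → ℝ} (ha : Measurable a) (hw : Measurable w)
    (ha0 : 0 ≤ a) (hw0 : 0 ≤ w) (ha_int : Integrable a (P.map y)) {C : ℝ}
    (hν : ∀ᵐ x ∂P.map y, Integrable w (ν x) ∧ ∫ v, w v ∂ν x ≤ C) :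
    Integrable (fun ω => a (y ω) * w (V ω)) P ∧
      ∫ ω, a (y ω) * w (V ω) ∂P ≤ C * ∫ ω, a (y ω) ∂P := by
  have hm : StronglyMeasurable fun p : α × β => a p.1 * w p.2 :=
    ((ha.comp measurable_fst).mul (hw.comp measurable_snd)).stronglyMeasurable
  have hle : ∀ᵐ x ∂P.map y, a x * ∫ v, w v ∂ν x ≤ C * a x := hν.mono fun x hx => by
    rw [mul_comm C]
    exact mul_le_mul_of_nonneg_left hx.2 (ha0 x)
  have hprod : Integrable (fun p : α × β => a p.1 * w p.2) (P.map y ⊗ₘ ν) := by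
    refine (Measure.integrable_compProd_iff hm.aestronglyMeasurable).2
      ⟨hν.mono fun x hx => hx.1.const_mul (a x), ?_⟩
    refine (ha_int.const_mul C).mono' hm.norm.integral_kernel_prod_right'.aestronglyMeasurable ?_
    filter_upwards [hle] with x hx
    rw [Real.norm_of_nonneg (integral_nonneg fun v => norm_nonneg _)]
    simpa only [norm_mul, Real.norm_of_nonneg (ha0 x), Real.norm_of_nonneg (hw0 _),
      integral_const_mul] using hx
  have hpair : AEMeasurable (fun ω => (y ω, V ω)) P := h.aemeasurable
  constructor
  · rw [← h.map_eq, integrable_map_measure hm.aestronglyMeasurable hpair] at hprod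
    exact hprod
  calc ∫ ω, a (y ω) * w (V ω) ∂P
      = ∫ x, a x * ∫ v, w v ∂ν x ∂P.map y := by
        simp only [← integral_const_mul]
        rw [← Measure.integral_compProd hprod, ← h.map_eq,
          integral_map hpair hm.aestronglyMeasurable]
    _ ≤ ∫ x, C * a x ∂P.map y := by
        exact integral_mono_of_nonneg
          (ae_of_all _ fun x => mul_nonneg (ha0 x) (integral_nonneg hw0)) (ha_int.const_mul C) hle
    _ = C * ∫ ω, a (y ω) ∂P := by
        rw [integral_const_mul, integral_map h.aemeasurable_fst ha.aestronglyMeasurable]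

variable [NormedAddCommGroup E] [InnerProductSpace ℝ E] [CompleteSpace E] [MeasurableSpace E]
  [BorelSpace E] [SecondCountableTopology E]

lemma integral_inner_eq_zero_of_hasCondDistrib {ν : Kernel α E} [IsSFiniteKernel ν] {V : Ω → E}
    (h : HasCondDistrib V y ν P) {a : α → E} (ha : Measurable a)
    (hν : ∀ᵐ x ∂P.map y, Integrable (fun v => v) (ν x) ∧ ∫ v, v ∂ν x = 0)
    (hint : Integrable (fun ω => ⟪V ω, a (y ω)⟫) P) : ∫ ω, ⟪V ω, a (y ω)⟫ ∂P = 0 := by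
  have hm : AEStronglyMeasurable (fun p : α × E => ⟪p.2, a p.1⟫) (P.map y ⊗ₘ ν) :=
    (measurable_snd.inner (ha.comp measurable_fst)).aestronglyMeasurable
  have hpair : AEMeasurable (fun ω => (y ω, V ω)) P := h.aemeasurable
  have hmap := h.map_eq
  have hprod : Integrable (fun p : α × E => ⟪p.2, a p.1⟫) (P.map y ⊗ₘ ν) := by
    rw [← hmap] at hm ⊢
    exact (integrable_map_measure hm hpair).2 hint
  calc ∫ ω, ⟪V ω, a (y ω)⟫ ∂P
      = ∫ x, ∫ v, ⟪v, a x⟫ ∂ν x ∂P.map y := by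
        rw [← Measure.integral_compProd hprod, ← hmap, integral_map hpair (hmap ▸ hm)]
    _ = 0 := integral_eq_zero_of_ae <| hν.mono fun x hx => by
        simp only [real_inner_comm (a x), Pi.zero_apply]
        rw [integral_inner hx.1 (a x), hx.2, inner_zero_right]

end ConditionalNoise

lemma measurable_indicator_of_continuousOn {X : Type*} [TopologicalSpace X] [MeasurableSpace X]
    [OpensMeasurableSpace X] {S : Set X} {f : X → ℝ} (hS : MeasurableSet S)
    (hf : ContinuousOn f S) : Measurable (S.indicator f) := by
  classical
  rw [← Set.piecewise_eq_indicator]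
  exact hf.measurable_piecewise continuousOn_const hS

section SecondMoment

variable {Ω E : Type*} [MeasurableSpace Ω] {P : Measure Ω} [IsProbabilityMeasure P]
  [NormedAddCommGroup E] [MeasurableSpace E] [BorelSpace E]

lemma integrable_one_add_norm_sq {ν : Measure E} [IsProbabilityMeasure ν] {C : ℝ}
    (h : ∫⁻ v, ‖v‖ₑ ^ 2 ∂ν ≤ ENNReal.ofReal C) :
    Integrable (fun v => (1 + ‖v‖) ^ 2) ν ∧ ∫ v, (1 + ‖v‖) ^ 2 ∂ν ≤ 2 + 2 * max C 0 := by
  have hsq_enorm : ∀ v : E, ENNReal.ofReal (‖v‖ ^ 2) = ‖v‖ₑ ^ 2 := fun v => by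
    rw [ENNReal.ofReal_pow (norm_nonneg v), ofReal_norm]
  have hsq_meas : AEStronglyMeasurable (fun v : E => ‖v‖ ^ 2) ν :=
    (measurable_norm.pow_const 2).aestronglyMeasurable
  have hsq_int : Integrable (fun v => ‖v‖ ^ 2) ν := by
    refine ⟨hsq_meas, ?_⟩
    rw [hasFiniteIntegral_iff_ofReal (ae_of_all _ fun v => sq_nonneg _)]
    simpa only [hsq_enorm] using h.trans_lt ENNReal.ofReal_lt_top
  have hsq_le : ∫ v, ‖v‖ ^ 2 ∂ν ≤ max C 0 := by
    rw [integral_eq_lintegral_of_nonneg_ae (ae_of_all _ fun v => sq_nonneg _) hsq_meas]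
    refine ENNReal.toReal_le_of_le_ofReal (le_max_right _ _) ?_
    simpa only [hsq_enorm] using h.trans (ENNReal.ofReal_le_ofReal (le_max_left _ _))
  have hbound : ∀ v : E, (1 + ‖v‖) ^ 2 ≤ 2 + 2 * ‖v‖ ^ 2 := fun v => by
    linarith [add_sq_le (a := 1) (b := ‖v‖)]
  have hbound_int : Integrable (fun v => 2 + 2 * ‖v‖ ^ 2) ν :=
    (integrable_const 2).add (hsq_int.const_mul 2)
  have hint : Integrable (fun v => (1 + ‖v‖) ^ 2) ν :=
    hbound_int.mono' ((measurable_norm.const_add 1).pow_const 2).aestronglyMeasurable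
      (ae_of_all _ fun v => (Real.norm_of_nonneg (sq_nonneg _)).trans_le (hbound v))
  refine ⟨hint, (integral_mono hint hbound_int hbound).trans ?_⟩
  rw [integral_add (integrable_const 2) (hsq_int.const_mul 2), integral_const_mul, integral_const,
    probReal_univ, one_smul]
  linarith

lemma integrable_one_add_norm {ν : Measure E} [IsProbabilityMeasure ν] {C : ℝ}
    (h : ∫⁻ v, ‖v‖ₑ ^ 2 ∂ν ≤ ENNReal.ofReal C) :
    Integrable (fun v => 1 + ‖v‖) ν ∧ ∫ v, (1 + ‖v‖) ∂ν ≤ 2 + 2 * max C 0 := by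
  obtain ⟨hsq_int, hsq_le⟩ := integrable_one_add_norm_sq h
  have hle : ∀ v : E, 1 + ‖v‖ ≤ (1 + ‖v‖) ^ 2 := fun v =>
    le_self_pow₀ (le_add_of_nonneg_right (norm_nonneg v)) two_ne_zero
  have hint : Integrable (fun v => 1 + ‖v‖) ν :=
    hsq_int.mono' (measurable_norm.const_add 1).aestronglyMeasurable
      (ae_of_all _ fun v => (Real.norm_of_nonneg (by positivity)).trans_le (hle v))
  exact ⟨hint, (integral_mono hint hsq_int hle).trans hsq_le⟩

variable {α : Type*} [MeasurableSpace α] {ν : Kernel α E} [IsMarkovKernel ν] {V : Ω → E}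
  {y : Ω → α} {C : ℝ}

lemma integrable_one_add_norm_sq_of_hasCondDistrib (h : HasCondDistrib V y ν P)
    (hν : ∀ᵐ x ∂P.map y, ∫⁻ v, ‖v‖ₑ ^ 2 ∂ν x ≤ ENNReal.ofReal C) :
    Integrable (fun ω => (1 + ‖V ω‖) ^ 2) P ∧ ∫ ω, (1 + ‖V ω‖) ^ 2 ∂P ≤ 2 + 2 * max C 0 := by
  have := Measure.isProbabilityMeasure_map h.aemeasurable_fst
  simpa only [one_mul, integral_const, probReal_univ, one_smul, mul_one] using
    integrable_mul_of_hasCondDistrib h (measurable_const (a := 1))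
      ((measurable_norm.const_add 1).pow_const 2) (fun _ => zero_le_one) (fun v => sq_nonneg _)
      (integrable_const 1)
      (hν.mono fun _ hx => integrable_one_add_norm_sq hx)

lemma integrable_mul_one_add_norm_of_hasCondDistrib (h : HasCondDistrib V y ν P)
    (hν : ∀ᵐ x ∂P.map y, ∫⁻ v, ‖v‖ₑ ^ 2 ∂ν x ≤ ENNReal.ofReal C) {a : α → ℝ} (ha : Measurable a)
    (ha0 : 0 ≤ a) (ha_int : Integrable a (P.map y)) :
    Integrable (fun ω => a (y ω) * (1 + ‖V ω‖)) P ∧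
      ∫ ω, a (y ω) * (1 + ‖V ω‖) ∂P ≤ (2 + 2 * max C 0) * ∫ ω, a (y ω) ∂P :=
  integrable_mul_of_hasCondDistrib h ha (measurable_norm.const_add 1) ha0
    (fun v => add_nonneg zero_le_one (norm_nonneg v)) ha_int
    (hν.mono fun _ hx => integrable_one_add_norm hx)

lemma integrable_inner_and_integral_eq_zero [InnerProductSpace ℝ E] [CompleteSpace E]
    [SecondCountableTopology E] (h : HasCondDistrib V y ν P)
    (hν : ∀ᵐ x ∂P.map y, ∫⁻ v, ‖v‖ₑ ^ 2 ∂ν x ≤ ENNReal.ofReal C)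
    (hmean : ∀ᵐ x ∂P.map y, ∫ v, v ∂ν x = 0) {a : α → E} (ha : Measurable a) {D : ℝ}
    (hD : ∀ᵐ ω ∂P, ‖a (y ω)‖ ≤ D) :
    Integrable (fun ω => ⟪V ω, a (y ω)⟫) P ∧ ∫ ω, ⟪V ω, a (y ω)⟫ ∂P = 0 := by
  have hνint : ∀ᵐ x ∂P.map y, Integrable (fun v => v) (ν x) := hν.mono fun _ hx =>
    (integrable_one_add_norm hx).1.mono' measurable_id.aestronglyMeasurable
      (ae_of_all _ fun v => le_add_of_nonneg_left zero_le_one)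
  have hint : Integrable (fun ω => ⟪V ω, a (y ω)⟫) P := by
    refine ((integrable_one_add_norm_sq_of_hasCondDistrib h hν).1.const_mul D).mono'
      (h.aemeasurable_snd.inner (ha.comp_aemeasurable h.aemeasurable_fst)).aestronglyMeasurable ?_
    filter_upwards [hD] with ω hω
    have hV : ‖V ω‖ ≤ (1 + ‖V ω‖) ^ 2 := by linarith [sq_nonneg ‖V ω‖, norm_nonneg (V ω)]
    calc ‖⟪V ω, a (y ω)⟫‖ ≤ ‖V ω‖ * ‖a (y ω)‖ := norm_inner_le_norm _ _
      _ ≤ (1 + ‖V ω‖) ^ 2 * D := mul_le_mul hV hω (norm_nonneg _) (sq_nonneg _)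
      _ = D * (1 + ‖V ω‖) ^ 2 := mul_comm _ _
  exact ⟨hint, integral_inner_eq_zero_of_hasCondDistrib h ha (hνint.and hmean) hint⟩

end SecondMoment

section StochasticSubgradient

variable {Ω E : Type*} [MeasurableSpace Ω] {P : Measure Ω} [IsProbabilityMeasure P]
  [NormedAddCommGroup E] [InnerProductSpace ℝ E] [CompleteSpace E] [MeasurableSpace E]
  [BorelSpace E] [SecondCountableTopology E] {S : Set E} {f : E → ℝ} {f' : E → E} {L ρ c C : ℝ}
  {γ : ℕ → ℝ} {V y : ℕ → Ω → E} {ν : ℕ → Kernel E E} [∀ t, IsMarkovKernel (ν t)]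

lemma ae_tendsto_zero_of_hasCondDistrib (hγ : ∀ t, 0 ≤ γ t) (hγ_sum : ¬ Summable γ)
    (hγ_sq : Summable fun t => γ t ^ 2)
    (hcond : ∀ t, HasCondDistrib (V t) (y t) (ν t) P)
    (hmean : ∀ t, ∀ᵐ x ∂P.map (y t), ∫ v, v ∂ν t x = 0)
    (hsecond : ∀ t, ∀ᵐ x ∂P.map (y t), ∫⁻ v, ‖v‖ₑ ^ 2 ∂ν t x ≤ ENNReal.ofReal C)
    {X : E → ℝ} (hX : Measurable X) (hX0 : 0 ≤ X) (hX_int : ∀ t, Integrable X (P.map (y t)))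
    {z : E} {D B K : ℝ} (hD : ∀ᵐ ω ∂P, ∀ t, ‖y t ω - z‖ ≤ D) (hB : 0 ≤ B)
    (hdrift : ∀ᵐ ω ∂P, ∀ T, ∑ t ∈ range T, γ t * X (y t ω) ≤
      B + ∑ t ∈ range T, γ t * ⟪V t ω, y t ω - z⟫ + B * ∑ t ∈ range T, (γ t * (1 + ‖V t ω‖)) ^ 2)
    (hstep : ∀ᵐ ω ∂P, ∀ t, X (y (t + 1) ω) ≤ X (y t ω) + K * (γ t * (1 + ‖V t ω‖))) :
    ∀ᵐ ω ∂P, Tendsto (fun t => X (y t ω)) atTop (𝓝 0) := by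
  have hR := fun t => integrable_one_add_norm_sq_of_hasCondDistrib (hcond t) (hsecond t)
  have hXR := fun t =>
    integrable_mul_one_add_norm_of_hasCondDistrib (hcond t) (hsecond t) hX hX0 (hX_int t)
  have hZ := fun t => integrable_inner_and_integral_eq_zero (hcond t) (hsecond t) (hmean t)
    (a := fun x => x - z) (measurable_id.sub_const z) ((ae_all_iff.1 hD) t)
  exact ae_tendsto_zero_of_drift hγ hγ_sum hγ_sq hB (ae_of_all _ fun ω t => hX0 _)
    (fun t => (hX_int t).comp_aemeasurable (hcond t).aemeasurable_fst)
    (fun t ω => le_add_of_nonneg_right (norm_nonneg (V t ω))) (fun t => (hR t).1)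
    (fun t => (hR t).2) (fun t => (hXR t).1) (fun t => (hXR t).2) (fun t => (hZ t).1)
    (fun t => (hZ t).2) hdrift hstep

lemma ae_tendsto_sub_min_of_isInexactSubgradientRun (hS : IsCompact S) (hconv : Convex ℝ S)
    (hf : IsLipschitzSubgradient S L f f') {z : E} (hz : z ∈ S) (hmin : ∀ x ∈ S, f z ≤ f x)
    (hρ0 : 0 ≤ ρ) (hρ1 : ρ < 1) (hc : 0 ≤ c) (hγ : ∀ t, 0 ≤ γ t) (hγ_sum : ¬ Summable γ)
    (hγ_sq : Summable fun t => γ t ^ 2)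
    (hrun : ∀ᵐ ω ∂P, ∃ ε, IsInexactSubgradientRun S f' γ ρ c (V · ω) (y · ω) ε)
    (hcond : ∀ t, HasCondDistrib (V t) (y t) (ν t) P)
    (hmean : ∀ t, ∀ x ∈ S, ∫ v, v ∂ν t x = 0)
    (hsecond : ∀ t, ∀ x ∈ S, ∫⁻ v, ‖v‖ₑ ^ 2 ∂ν t x ≤ ENNReal.ofReal C) :
    ∀ᵐ ω ∂P, Tendsto (fun t => f (y t ω) - f z) atTop (𝓝 0) := by
  have hmem : ∀ᵐ ω ∂P, ∀ t, y t ω ∈ S := hrun.mono fun ω ⟨ε, h⟩ => h.mem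
  have hlaw : ∀ t, ∀ᵐ x ∂P.map (y t), x ∈ S := fun t =>
    (ae_map_iff (hcond t).aemeasurable_fst hS.measurableSet).2 ((ae_all_iff.1 hmem) t)
  have hgap : ContinuousOn (fun x => f x - f z) S := hf.continuousOn.sub continuousOn_const
  set X : E → ℝ := S.indicator fun x => f x - f z
  have hX : ∀ x ∈ S, X x = f x - f z := fun x hx => Set.indicator_of_mem hx _
  have hX_meas : Measurable X := measurable_indicator_of_continuousOn hS.measurableSet hgap
  have hX_int : ∀ t, Integrable X (P.map (y t)) := fun t => by
    have := Measure.isProbabilityMeasure_map (hcond t).aemeasurable_fst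
    obtain ⟨M, hM⟩ := hS.exists_bound_of_continuousOn hgap
    refine (integrable_const M).mono' hX_meas.aestronglyMeasurable ((hlaw t).mono fun x hx => ?_)
    simpa only [hX x hx] using hM x hx
  have hdiam : ∀ᵐ ω ∂P, ∀ t, ‖y t ω - z‖ ≤ Metric.diam S := hmem.mono fun ω hω t => by
    rw [← dist_eq_norm]
    exact Metric.dist_le_diam_of_mem hS.isBounded (hω t) hz
  obtain ⟨B, hB0, hB⟩ :=
    exists_inexactSubgradientRun_bound hconv hS.isBounded hf hγ hρ0 hρ1 hc
  have hlim : ∀ᵐ ω ∂P, Tendsto (fun t => X (y t ω)) atTop (𝓝 0) := by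
    refine ae_tendsto_zero_of_hasCondDistrib hγ hγ_sum hγ_sq hcond
      (fun t => (hlaw t).mono (hmean t)) (fun t => (hlaw t).mono (hsecond t)) hX_meas
      (Set.indicator_nonneg fun x hx => sub_nonneg.2 (hmin x hx)) hX_int hdiam hB0
      (hrun.mono fun ω ⟨ε, h⟩ T => ?_) (K := L * B) (hrun.mono fun ω ⟨ε, h⟩ t => ?_)
    · simpa only [hX _ (h.mem _)] using (hB _ _ _ h).2 z hz T
    · rw [hX _ (h.mem t), hX _ (h.mem (t + 1)), mul_assoc]
      have hstep := mul_le_mul_of_nonneg_left ((hB _ _ _ h).1 t) hf.nonneg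
      linarith [(abs_le.1 (hf.abs_sub_le (h.mem t) (h.mem (t + 1)))).2]
  filter_upwards [hmem, hlim] with ω hω hωlim
  exact hωlim.congr fun t => hX _ (hω t)

theorem ae_tendsto_infDist_of_isInexactSubgradientRun (hS : IsCompact S) (hconv : Convex ℝ S)
    (hf : IsLipschitzSubgradient S L f f')
    (hρ0 : 0 ≤ ρ) (hρ1 : ρ < 1) (hc : 0 ≤ c) (hγ : ∀ t, 0 ≤ γ t) (hγ_sum : ¬ Summable γ)
    (hγ_sq : Summable fun t => γ t ^ 2)
    (hrun : ∀ᵐ ω ∂P, ∃ ε, IsInexactSubgradientRun S f' γ ρ c (V · ω) (y · ω) ε)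
    (hcond : ∀ t, HasCondDistrib (V t) (y t) (ν t) P)
    (hmean : ∀ t, ∀ x ∈ S, ∫ v, v ∂ν t x = 0)
    (hsecond : ∀ t, ∀ x ∈ S, ∫⁻ v, ‖v‖ₑ ^ 2 ∂ν t x ≤ ENNReal.ofReal C) :
    {x | x ∈ S ∧ ∀ w ∈ S, f x ≤ f w}.Nonempty ∧ ∀ᵐ ω ∂P, Tendsto
      (fun t => Metric.infDist (y t ω) {x | x ∈ S ∧ ∀ w ∈ S, f x ≤ f w}) atTop (𝓝 0) := by
  obtain ⟨ω, ε, hω⟩ := hrun.exists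
  obtain ⟨z, hz, hmin⟩ := hS.exists_isMinOn ⟨y 0 ω, hω.mem_zero⟩ hf.continuousOn
  refine ⟨⟨z, hz, hmin⟩, ?_⟩
  filter_upwards [hrun, ae_tendsto_sub_min_of_isInexactSubgradientRun hS hconv hf hz hmin hρ0 hρ1
    hc hγ hγ_sum hγ_sq hrun hcond hmean hsecond] with ω ⟨ε, h⟩ hlim
  exact tendsto_infDist_minimizers hS hf.continuousOn hmin h.mem hlim

end StochasticSubgradient

/-! ### Trajectories of the consensus algorithm -/

section Trajectory

variable {ι κ : Type*} {n : ι → ℕ} {G : ∀ i, Set (EuclideanSpace ℝ (Fin (n i)))}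
  {gradφ : ∀ i, EuclideanSpace ℝ (Fin (n i)) → EuclideanSpace ℝ (Fin (n i))}
  {g : ∀ i, κ → EuclideanSpace ℝ (Fin (n i)) → ℝ}
  {gradg : ∀ i, κ → EuclideanSpace ℝ (Fin (n i)) → EuclideanSpace ℝ (Fin (n i))}
  {μ : ℝ} {Lg : ι → κ → ℝ} {y p : Decision n}

/-- The local constraint values `g_{i,k}(y_i)`, the signal whose average over the agents the
estimates `e_{i,k}` track. -/
def constraintValues (g : ∀ i, κ → EuclideanSpace ℝ (Fin (n i)) → ℝ) (y : Decision n) :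
    ι → κ → ℝ :=
  fun i k => g i k (y i)

variable [Fintype ι]

lemma isEuclideanProj_feasibleSet {x : Decision n}
    (h : ∀ i, IsEuclideanProj (G i) (x i) (p i)) : IsEuclideanProj (feasibleSet G) x p := by
  refine ⟨fun i => (h i).1, fun q hq => ?_⟩
  rw [PiLp.norm_eq_of_L2, PiLp.norm_eq_of_L2]
  exact Real.sqrt_le_sqrt (sum_le_sum fun i _ =>
    pow_le_pow_left₀ (norm_nonneg _) ((h i).2 (q i) (hq i)) 2)

variable [Fintype κ]

lemma norm_constraintValues_sub_le
    (hg : ∀ i k, IsLipschitzSubgradient (G i) (Lg i k) (g i k) (gradg i k))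
    (hy : y ∈ feasibleSet G) (hp : p ∈ feasibleSet G) :
    ‖constraintValues g p - constraintValues g y‖ ≤ (∑ i, ∑ k, Lg i k) * ‖p - y‖ := by
  have hL : ∀ i k, 0 ≤ Lg i k := fun i k => (hg i k).nonneg
  have hΛ : 0 ≤ ∑ i, ∑ k, Lg i k := sum_nonneg fun i _ => sum_nonneg fun k _ => hL i k
  refine (pi_norm_le_iff_of_nonneg (by positivity)).2 fun i =>
    (pi_norm_le_iff_of_nonneg (by positivity)).2 fun k => ?_
  calc ‖g i k (p i) - g i k (y i)‖ ≤ Lg i k * ‖p i - y i‖ := (hg i k).abs_sub_le (hy i) (hp i)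
    _ ≤ (∑ i, ∑ k, Lg i k) * ‖p - y‖ := by
        refine mul_le_mul ?_ (PiLp.norm_apply_le (p - y) i) (norm_nonneg _) hΛ
        exact (single_le_sum (fun k _ => hL i k) (mem_univ k)).trans
          (single_le_sum (f := fun i => ∑ k, Lg i k)
            (fun i _ => sum_nonneg fun k _ => hL i k) (mem_univ i))

lemma exists_norm_constraintValues_le (hG : ∀ i, IsCompact (G i))
    (hg : ∀ i k, IsLipschitzSubgradient (G i) (Lg i k) (g i k) (gradg i k)) :
    ∃ M, ∀ y ∈ feasibleSet G, ‖constraintValues g y‖ ≤ M :=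
  (isCompact_feasibleSet hG).exists_bound_of_continuousOn <|
    continuousOn_pi.2 fun i => continuousOn_pi.2 fun k =>
      (hg i k).continuousOn.comp (by fun_prop) fun _ hy => hy i

lemma updateDirection_add_penalizedGradient_sub (e : ι → κ → ℝ) (v : Decision n) (i : ι) :
    updateDirection gradφ gradg μ y e v i + penalizedGradient gradφ g gradg μ y i - v i =
      μ • ∑ k, (max 0 (mean ι (κ → ℝ) (constraintValues g y) k) - max 0 (e i k)) •
        gradg i k (y i) := by
  have hmean : ∀ k, max 0 (mean ι (κ → ℝ) (constraintValues g y) k) =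
      (Fintype.card ι : ℝ)⁻¹ * max 0 (globalConstraint g k y) := fun k => by
    rw [mul_max_of_nonneg _ _ (by positivity), mul_zero, mean_apply]
    simp only [Pi.smul_apply, Finset.sum_apply, smul_eq_mul, globalConstraint, constraintValues]
  have hgradient : penalizedGradient gradφ g gradg μ y i = gradφ i (y i) +
      (μ / Fintype.card ι) • ∑ k, max 0 (globalConstraint g k y) • gradg i k (y i) := by
    simp only [penalizedGradient, PiLp.add_apply, PiLp.smul_apply, WithLp.ofLp_sum,
      Finset.sum_apply]
  simp only [updateDirection, hgradient, hmean, sub_smul, sum_sub_distrib, mul_smul, ← smul_sum]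
  module

lemma abs_inner_updateDirection_add_penalizedGradient_sub_le (hμ : 0 ≤ μ)
    (hg : ∀ i k, IsLipschitzSubgradient (G i) (Lg i k) (g i k) (gradg i k))
    (hy : y ∈ feasibleSet G) (hp : p ∈ feasibleSet G) (e : ι → κ → ℝ) (v : Decision n) :
    |⟪WithLp.toLp 2 (updateDirection gradφ gradg μ y e v) + penalizedGradient gradφ g gradg μ y - v,
      p - y⟫| ≤ μ * (∑ i, ∑ k, Lg i k) *
        ‖e - fun _ => mean ι (κ → ℝ) (constraintValues g y)‖ * ‖p - y‖ := by
  set m := mean ι (κ → ℝ) (constraintValues g y)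
  have hterm : ∀ i k, |(max 0 (m k) - max 0 (e i k)) * ⟪gradg i k (y i), p i - y i⟫| ≤
      ‖e - fun _ => m‖ * (Lg i k * ‖p - y‖) := fun i k => by
    rw [abs_mul]
    refine mul_le_mul ?_ ?_ (abs_nonneg _) (norm_nonneg _)
    · rw [abs_sub_comm]
      exact (abs_max_sub_max_le_abs (e i k) (m k) 0 |>.trans_eq' (by simp only [max_comm])).trans
        ((norm_le_pi_norm ((e - (fun _ => m : ι → κ → ℝ)) i) k).trans (norm_le_pi_norm _ i))
    · exact ((hg i k).abs_inner_le (hy i) (hp i)).trans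
        (mul_le_mul_of_nonneg_left (PiLp.norm_apply_le (p - y) i) (hg i k).nonneg)
  have hexpand : ⟪WithLp.toLp 2 (updateDirection gradφ gradg μ y e v) +
      penalizedGradient gradφ g gradg μ y - v, p - y⟫ =
      μ * ∑ i, ∑ k, (max 0 (m k) - max 0 (e i k)) * ⟪gradg i k (y i), p i - y i⟫ := by
    rw [PiLp.inner_apply, mul_sum]
    refine sum_congr rfl fun i _ => ?_
    rw [PiLp.sub_apply, PiLp.add_apply, updateDirection_add_penalizedGradient_sub,
      real_inner_smul_left, sum_inner]
    simp only [real_inner_smul_left, PiLp.sub_apply, m]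
  rw [hexpand, abs_mul, abs_of_nonneg hμ, mul_assoc, mul_assoc]
  refine mul_le_mul_of_nonneg_left ?_ hμ
  calc |∑ i, ∑ k, (max 0 (m k) - max 0 (e i k)) * ⟪gradg i k (y i), p i - y i⟫|
      ≤ ∑ i, ∑ k, ‖e - fun _ => m‖ * (Lg i k * ‖p - y‖) :=
        (abs_sum_le_sum_abs _ _).trans <| sum_le_sum fun i _ =>
          (abs_sum_le_sum_abs _ _).trans <| sum_le_sum fun k _ => hterm i k
    _ = (∑ i, ∑ k, Lg i k) * (‖e - fun _ => m‖ * ‖p - y‖) := by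
        simp only [← mul_sum, ← sum_mul]
        ring

variable {W : Matrix ι ι ℝ} {γ : ℕ → ℝ}

lemma IsTrajectory.mem_feasibleSet {V y : ℕ → Decision n} {e : ℕ → ι → κ → ℝ}
    (h : IsTrajectory G gradφ g gradg μ W γ V y e) (t : ℕ) : y t ∈ feasibleSet G := by
  cases t with
  | zero => exact h.y_zero
  | succ t => exact fun i => (h.y_succ t i).1

lemma exists_isInexactSubgradientRun_of_isTrajectory [DecidableEq ι] [Nonempty ι]
    (hG : ∀ i, IsCompact (G i))
    (hg : ∀ i k, IsLipschitzSubgradient (G i) (Lg i k) (g i k) (gradg i k)) (hμ : 0 ≤ μ)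
    (hW : W ∈ doublyStochastic ℝ ι) (hprim : W.IsPrimitive) :
    ∃ ρ c, 0 ≤ ρ ∧ ρ < 1 ∧ 0 ≤ c ∧ ∀ V y e, IsTrajectory G gradφ g gradg μ W γ V y e →
      ∃ ε, IsInexactSubgradientRun (feasibleSet G) (penalizedGradient gradφ g gradg μ) γ ρ c
        V y ε := by
  obtain ⟨ρ, K, hρ0, hρ1, hK, htrack⟩ := exists_consensus_tracking_bound (κ → ℝ) hW hprim
  obtain ⟨M, hM⟩ := exists_norm_constraintValues_le hG hg
  set Λ := ∑ i, ∑ k, Lg i k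
  have hΛ : 0 ≤ Λ := sum_nonneg fun i _ => sum_nonneg fun k _ => (hg i k).nonneg
  refine ⟨ρ, μ * Λ * (K * (|M| + Λ)), hρ0, hρ1, by positivity, fun V y e h => ?_⟩
  obtain ⟨ε, hε, hε_zero, hε_succ⟩ := htrack (fun t => constraintValues g (y t)) e
    (funext₂ h.e_zero) fun t => funext₂ fun i k => by
      simp only [h.e_succ, Matrix.Module.smul_apply, Pi.add_apply, Pi.sub_apply, Finset.sum_apply,
        Pi.smul_apply, smul_eq_mul, constraintValues]
      ring
  have hμΛ : 0 ≤ μ * Λ := mul_nonneg hμ hΛ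
  refine ⟨fun t => μ * Λ * ε t, h.y_zero, fun t => ?_, fun t => ?_, ?_, fun t => ?_⟩
  · refine ⟨WithLp.toLp 2 (updateDirection gradφ gradg μ (y t) (e t) (V t)),
      isEuclideanProj_feasibleSet (h.y_succ t), fun p hp => ?_⟩
    refine (abs_inner_updateDirection_add_penalizedGradient_sub_le hμ hg (h.mem_feasibleSet t) hp
      (e t) (V t)).trans ?_
    exact mul_le_mul_of_nonneg_right (mul_le_mul_of_nonneg_left (hε t) hμΛ) (norm_nonneg _)
  · exact mul_nonneg hμΛ ((norm_nonneg _).trans (hε t))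
  · refine mul_le_mul_of_nonneg_left (hε_zero.trans (mul_le_mul_of_nonneg_left ?_ hK)) hμΛ
    linarith [hM _ h.y_zero, le_abs_self M]
  · have hstep : K * ‖constraintValues g (y (t + 1)) - constraintValues g (y t)‖ ≤
        K * ((|M| + Λ) * ‖y (t + 1) - y t‖) := by
      refine mul_le_mul_of_nonneg_left ((norm_constraintValues_sub_le hg (h.mem_feasibleSet t)
        (h.mem_feasibleSet (t + 1))).trans ?_) hK
      exact mul_le_mul_of_nonneg_right (le_add_of_nonneg_left (abs_nonneg M)) (norm_nonneg _)
    linarith [mul_le_mul_of_nonneg_left ((hε_succ t).trans (add_le_add_right hstep _)) hμΛ]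

end Trajectory

end PenaltyConsensus

open MeasureTheory ProbabilityTheory Filter Topology PenaltyConsensus in
theorem theorem1_general {ι κ : Type*} [Fintype ι] [DecidableEq ι] [Nonempty ι] [Fintype κ]
    {n : ι → ℕ} {G : ∀ i, Set (EuclideanSpace ℝ (Fin (n i)))}
    (hG_compact : ∀ i, IsCompact (G i)) (hG_convex : ∀ i, Convex ℝ (G i))
    {φ : ∀ i, EuclideanSpace ℝ (Fin (n i)) → ℝ}
    {gradφ : ∀ i, EuclideanSpace ℝ (Fin (n i)) → EuclideanSpace ℝ (Fin (n i))}
    (hφ : ∀ i, ∃ L, IsLipschitzSubgradient (G i) L (φ i) (gradφ i))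
    {g : ∀ i, κ → EuclideanSpace ℝ (Fin (n i)) → ℝ}
    {gradg : ∀ i, κ → EuclideanSpace ℝ (Fin (n i)) → EuclideanSpace ℝ (Fin (n i))}
    (hg : ∀ i k, ∃ L, IsLipschitzSubgradient (G i) L (g i k) (gradg i k))
    {μ : ℝ} (hμ : 0 ≤ μ) {W : Matrix ι ι ℝ} (hW : W ∈ doublyStochastic ℝ ι)
    (hprim : W.IsPrimitive) {γ : ℕ → ℝ} (hγ_nonneg : ∀ t, 0 ≤ γ t)
    (hγ_sum : Tendsto (fun T => ∑ t ∈ Finset.range T, γ t) atTop atTop)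
    (hγ_sq : Summable fun t => γ t ^ 2)
    {Ω : Type*} [MeasurableSpace Ω] {P : Measure Ω} [IsProbabilityMeasure P]
    {V y : ℕ → Ω → Decision n} {e : ℕ → Ω → ι → κ → ℝ}
    (hrun : ∀ᵐ ω ∂P, IsTrajectory G gradφ g gradg μ W γ (V · ω) (y · ω) (e · ω))
    {ν : ℕ → Kernel (Decision n) (Decision n)} [∀ t, IsMarkovKernel (ν t)]
    (hcond : ∀ t, HasCondDistrib (V t) (y t) (ν t) P)
    (hmean : ∀ t, ∀ x ∈ feasibleSet G, ∫ v, v ∂(ν t x) = 0)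
    (hsecond : ∃ C : ℝ, ∀ t, ∀ x ∈ feasibleSet G, ∫⁻ v, ‖v‖ₑ ^ 2 ∂(ν t x) ≤ ENNReal.ofReal C) :
    (optimalSet G φ g μ).Nonempty ∧
      ∀ᵐ ω ∂P, Tendsto (fun t => Metric.infDist (y t ω) (optimalSet G φ g μ)) atTop (𝓝 0) := by
  choose Lφ hφ using hφ
  choose Lg hg using hg
  obtain ⟨C, hsecond⟩ := hsecond
  obtain ⟨L, hΦ⟩ := exists_isLipschitzSubgradient_penalizedObjective hG_compact hφ hg hμ
  obtain ⟨ρ, c, hρ0, hρ1, hc, hinexact⟩ := exists_isInexactSubgradientRun_of_isTrajectory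
    (gradφ := gradφ) (γ := γ) hG_compact hg hμ hW hprim
  have hγ_not_summable : ¬ Summable γ := fun h =>
    not_tendsto_nhds_of_tendsto_atTop hγ_sum _ h.hasSum.tendsto_sum_nat
  exact ae_tendsto_infDist_of_isInexactSubgradientRun (isCompact_feasibleSet hG_compact)
    (convex_feasibleSet hG_convex) hΦ hρ0 hρ1 hc hγ_nonneg hγ_not_summable hγ_sq
    (hrun.mono fun ω h => hinexact _ _ _ h) hcond hmean hsecond

open MeasureTheory ProbabilityTheory Filter Topology PenaltyConsensus in
theorem theorem1
    {ι κ : Type*} [Fintype ι] [DecidableEq ι] [Nonempty ι] [Fintype κ] {n : ι → ℕ}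
    -- local constraint sets: nonempty, compact and convex
    (G : ∀ i, Set (EuclideanSpace ℝ (Fin (n i))))
    (hG_nonempty : ∀ i, (G i).Nonempty)
    (hG_compact : ∀ i, IsCompact (G i))
    (hG_convex : ∀ i, Convex ℝ (G i))
    -- local objective functions: convex and Lipschitz on `G i`, with gradient `gradφ i`
    (φ : ∀ i, EuclideanSpace ℝ (Fin (n i)) → ℝ)
    (gradφ : ∀ i, EuclideanSpace ℝ (Fin (n i)) → EuclideanSpace ℝ (Fin (n i)))
    (hφ_convex : ∀ i, ConvexOn ℝ (G i) (φ i))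
    (hφ_lipschitz : ∀ i, ∃ L, LipschitzOnWith L (φ i) (G i))
    (hφ_grad : ∀ i, ∀ x ∈ G i, HasGradientWithinAt (φ i) (gradφ i x) (G i) x)
    -- constraint functions: convex and Lipschitz on `G i`, with gradient `gradg i k`
    (g : ∀ i, κ → EuclideanSpace ℝ (Fin (n i)) → ℝ)
    (gradg : ∀ i, κ → EuclideanSpace ℝ (Fin (n i)) → EuclideanSpace ℝ (Fin (n i)))
    (hg_convex : ∀ i k, ConvexOn ℝ (G i) (g i k))
    (hg_lipschitz : ∀ i k, ∃ L, LipschitzOnWith L (g i k) (G i))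
    (hg_grad : ∀ i k, ∀ x ∈ G i, HasGradientWithinAt (g i k) (gradg i k x) (G i) x)
    -- penalty parameter
    (μ : ℝ) (hμ : 0 < μ)
    -- weight matrix: doubly stochastic, strongly connected and aperiodic
    (W : Matrix ι ι ℝ)
    (hW_stochastic : W ∈ doublyStochastic ℝ ι)
    (hW_connected : W.IsIrreducible)
    (hW_aperiodic : W.IsPrimitive)
    -- step sizes
    (γ : ℕ → ℝ) (hγ_nonneg : ∀ t, 0 ≤ γ t)
    (hγ_sum : Tendsto (fun T => ∑ t ∈ Finset.range T, γ t) atTop atTop)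
    (hγ_sq : Summable fun t => γ t ^ 2)
    -- random decisions `y`, estimates `e` and perturbations `V` following the algorithm
    {Ω : Type*} [MeasurableSpace Ω] (P : Measure Ω) [IsProbabilityMeasure P]
    (V y : ℕ → Ω → Decision n) (e : ℕ → Ω → ι → κ → ℝ)
    (hV_meas : ∀ t, Measurable (V t)) (hy_meas : ∀ t, Measurable (y t))
    (h_run : ∀ ω, IsTrajectory G gradφ g gradg μ W γ
      (fun t => V t ω) (fun t => y t ω) (fun t => e t ω))
    -- given `y(t) = x`, the perturbation `V(t)` has law `ν x`, centred, with bounded second moment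
    (ν : Kernel (Decision n) (Decision n)) [IsMarkovKernel ν]
    (hν_cond : ∀ t, HasCondDistrib (V t) (y t) ν P)
    (hν_mean : ∀ x ∈ feasibleSet G, ∫ v, v ∂(ν x) = 0)
    (hν_second : ∃ C : ℝ, ∀ x ∈ feasibleSet G, ∫⁻ v, ‖v‖ₑ ^ 2 ∂(ν x) ≤ ENNReal.ofReal C) :
    (optimalSet G φ g μ).Nonempty ∧
      ∀ᵐ ω ∂P, Tendsto (fun t => Metric.infDist (y t ω) (optimalSet G φ g μ)) atTop (𝓝 0) := by
  exact theorem1_general hG_compact hG_convex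
    (fun i => (hφ_lipschitz i).imp' (↑) fun _ hL =>
      isLipschitzSubgradient_of_hasGradientWithinAt (hφ_convex i) hL (hφ_grad i))
    (fun i k => (hg_lipschitz i k).imp' (↑) fun _ hL =>
      isLipschitzSubgradient_of_hasGradientWithinAt (hg_convex i k) hL (hg_grad i k))
    hμ.le hW_stochastic hW_aperiodic hγ_nonneg hγ_sum hγ_sq (ae_of_all P h_run) hν_cond
    (fun _ => hν_mean) (hν_second.imp fun _ hC _ => hC)
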